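/- Definitions. Kets $|0\rangle,|1\rangle,\dots$ denote the standard orthonormal basis and $|x,y\rangle=|x\rangle\otimes|y\rangle$. A subspace $V\subseteq\mathcal H_A\otimes\mathcal H_B$ is called entanglement-breaking (EB) if, for all finite-dimensional systems $a,b$ and every unit vector $|\Psi\rangle\in V\otimes\mathcal H_{ab}$ (with $\mathcal H_{ab}=\mathcal H_a\otimes\mathcal H_b$), the state $\operatorname{Tr}_B|\Psi\rangle\langle\Psi|$ on $\mathcal H_A\otimes\mathcal H_{ab}$ is separable between $A$ and $ab$, i.e. a finite convex combination $\sum_n q_n\,|\mu_n\rangle\langle\mu_n|\otimes|\nu_n\rangle\langle\nu_n|$ of pure product states. Two subspaces $S,T\subseteq\mathcal H_A\otimes\mathcal H_B$ are LU equivalent if $(U\otimes U')S=T$ for some unitary $U$ on $\mathcal H_A$ and some unitary $U'$ on $\mathcal H_B$. Theorem. Let $V$ be a subspace of $\mathbb C^m\otimes\mathbb C^3$. If $V$ is nonzero and EB, then $\dim V\in\{1,2,3\}$. Moreover: (i) If $\dim V=1$, then $V$ is EB. (ii) If $\dim V=2$, then $V$ is EB if and only if $V$ is spanned by $(W\otimes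 X)\mathcal S$ for some complex $m\times 3$ matrix $W$, some unitary $3\times3$ matrix $X$, and some $\mathcal S$ that is one of the following (unnormalized) bases of subspaces of $\mathbb C^3\otimes\mathbb C^3$: $$\{|0,0\rangle,\ |1,1\rangle+|2,2\rangle\},\qquad \{|0,0\rangle+|1,1\rangle,\ |1,1\rangle+|2,2\rangle\},$$ $$\{|0,0\rangle+|1,1\rangle,\ |0,1\rangle+|1\rangle\otimes(d|0\rangle+fe^{i\theta}|1\rangle+g|2\rangle)\},$$ where in the third family the real numbers $g>0$ and $d,f,\theta\ge0$ satisfy $$-1-f^2+g^2-d^2(-2+d^2+f^2+g^2)+2df^2\cos2\theta\ \ge\ 0 .$$ (iii) If $\dim V=3$, then $V$ is EB if and only if $V$ is LU equivalent to the span of $|x,0\rangle,|y,1\rangle,|z,2\rangle$ for some $x,y,z\in\mathbb C^m$. -/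

import Mathlib

open scoped Kronecker

namespace EBSpace

/-! Pure states of a system with orthonormal basis indexed by `ι` are vectors `ι → ℂ`; the Hilbert
space `ℂ^m ⊗ ℂ^n` is `Fin m × Fin n → ℂ`, operators are complex matrices. -/

/-- The computational basis vector `|i⟩`. -/
def ket {n : ℕ} (i : Fin n) : Fin n → ℂ := Pi.single i 1

/-- The product vector `x ⊗ y`, also written `|x, y⟩`. -/
def prodVec {ι κ : Type*} (x : ι → ℂ) (y : κ → ℂ) : ι × κ → ℂ := fun p => x p.1 * y p.2

/-- `ψ` is a normalized vector, `⟨ψ|ψ⟩ = 1`. -/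
def IsNormalized {ι : Type*} [Fintype ι] (ψ : ι → ℂ) : Prop := star ψ ⬝ᵥ ψ = 1

/-- The rank-one operator `|ψ⟩⟨ψ|`. -/
def proj {ι : Type*} (ψ : ι → ℂ) : Matrix ι ι ℂ := Matrix.vecMulVec ψ (star ψ)

/-- The subspace `V ⊗ H` of the tensor product, where `H = κ → ℂ` is the whole second space:
the span of all `v ⊗ φ` with `v ∈ V` and `φ ∈ H`. -/
def tensorFull {ι : Type*} (V : Submodule ℂ (ι → ℂ)) (κ : Type*) :
    Submodule ℂ (ι × κ → ℂ) :=
  Submodule.span ℂ {ψ | ∃ v ∈ V, ∃ φ : κ → ℂ, ψ = prodVec v φ}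

/-- Partial trace over the system `B` of an operator on `(A ⊗ B) ⊗ E`; an operator on `A ⊗ E`. -/
def traceB {A B E : Type*} [Fintype B] (ρ : Matrix ((A × B) × E) ((A × B) × E) ℂ) :
    Matrix (A × E) (A × E) ℂ :=
  Matrix.of fun s t => ∑ b, ρ ((s.1, b), s.2) ((t.1, b), t.2)

/-- A separable bipartite state on `A ⊗ E`: a finite convex combination
`∑ n, q n • |μ n⟩⟨μ n| ⊗ |ν n⟩⟨ν n|` of pure product states. -/
def IsSeparable {A E : Type*} [Fintype A] [Fintype E] (ρ : Matrix (A × E) (A × E) ℂ) : Prop :=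
  ∃ (N : ℕ) (q : Fin N → ℝ) (μ : Fin N → A → ℂ) (ν : Fin N → E → ℂ),
    (∀ n, 0 ≤ q n) ∧ ∑ n, q n = 1 ∧
    (∀ n, IsNormalized (μ n)) ∧ (∀ n, IsNormalized (ν n)) ∧
    ρ = ∑ n, (q n : ℂ) • (proj (μ n) ⊗ₖ proj (ν n))

/-- `V ⊆ H_A ⊗ H_B` is an entanglement-breaking (EB) space: for all finite-dimensional systems
`a`, `b` and every pure state `Ψ ∈ V ⊗ H_ab`, tracing out `B` leaves a state of `A : ab` that is
separable. -/
def IsEB {A B : Type*} [Fintype A] [Fintype B] (V : Submodule ℂ (A × B → ℂ)) : Prop :=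
  ∀ (p q : ℕ) (Ψ : (A × B) × (Fin p × Fin q) → ℂ),
    Ψ ∈ tensorFull V (Fin p × Fin q) → IsNormalized Ψ → IsSeparable (traceB (proj Ψ))

/-- The product operator `W ⊗ X` from `H_A ⊗ H_B` to `H_A' ⊗ H_B'`. -/
noncomputable def localOp {A A' B B' : Type*} [Fintype A] [Fintype B]
    (W : Matrix A' A ℂ) (X : Matrix B' B ℂ) : (A × B → ℂ) →ₗ[ℂ] (A' × B' → ℂ) :=
  Matrix.mulVecLin (W ⊗ₖ X)

/-- Two subspaces of `H_A ⊗ H_B` are locally unitarily (LU) equivalent when a product unitary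
`U ⊗ U'` maps the first onto the second. -/
def LUEquivalent {A B : Type*} [Fintype A] [Fintype B] [DecidableEq A] [DecidableEq B]
    (S T : Submodule ℂ (A × B → ℂ)) : Prop :=
  ∃ U ∈ Matrix.unitaryGroup A ℂ, ∃ U' ∈ Matrix.unitaryGroup B ℂ, S.map (localOp U U') = T

/-- `|0,0⟩`, `|1,1⟩ + |2,2⟩`. -/
def basis₁ : Set (Fin 3 × Fin 3 → ℂ) :=
  {prodVec (ket 0) (ket 0),
   prodVec (ket 1) (ket 1) + prodVec (ket 2) (ket 2)}

/-- `|0,0⟩ + |1,1⟩`, `|1,1⟩ + |2,2⟩`. -/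
def basis₂ : Set (Fin 3 × Fin 3 → ℂ) :=
  {prodVec (ket 0) (ket 0) + prodVec (ket 1) (ket 1),
   prodVec (ket 1) (ket 1) + prodVec (ket 2) (ket 2)}

/-- `|0,0⟩ + |1,1⟩`, `|0,1⟩ + |1⟩ (d |0⟩ + f e^{iθ} |1⟩ + g |2⟩)`. -/
noncomputable def basis₃ (d f g θ : ℝ) : Set (Fin 3 × Fin 3 → ℂ) :=
  {prodVec (ket 0) (ket 0) + prodVec (ket 1) (ket 1),
   prodVec (ket 0) (ket 1) +
     prodVec (ket 1) ((d : ℂ) • ket 0 + ((f : ℂ) * Complex.exp (Complex.I * θ)) • ket 1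
       + (g : ℂ) • ket 2)}

/-- The constraints on the parameters of the third family. -/
def Admissible (d f g θ : ℝ) : Prop :=
  0 < g ∧ 0 ≤ d ∧ 0 ≤ f ∧ 0 ≤ θ ∧
    0 ≤ -1 - f ^ 2 + g ^ 2 - d ^ 2 * (-2 + d ^ 2 + f ^ 2 + g ^ 2)
      + 2 * d * f ^ 2 * Real.cos (2 * θ)

/-- `S` is one of the three canonical bases (the third one being a parametrized family). -/
def IsCanonicalBasis (S : Set (Fin 3 × Fin 3 → ℂ)) : Prop :=
  S = basis₁ ∨ S = basis₂ ∨ ∃ d f g θ : ℝ, Admissible d f g θ ∧ S = basis₃ d f g θ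

end EBSpace

/-! A nonzero space is EB exactly when the identity on `B` is a sum of rank-one operators `proj (u
n)` such that contracting all of `V` with any one `u n` leaves a single line in `A` (`isEB_iff`).
Tracing out `B` along such a frame gives a sum of projections onto product vectors. Conversely, EB
is applied to the vector that pairs a basis of `V` with an orthonormal basis of the ancilla. The
reduced state then has two factorizations, one through product vectors, and the coisometry relating
them (`exists_coisometry`) supplies the frame.

A frame of `ℂ³` contains a basis. If `c i` is its dual basis, `V` lies in the span of three products
`x i ⊗ c i`, so its dimension is at most 3. In dimension 3, nonparallel `x i`, `x j` force the forms
`c i`, `c j` to have zero product at every frame vector, hence to be orthogonal by Parseval. The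
frame can then be replaced by an orthonormal basis.

In dimension 2 the same replacement works unless the frame lies on a nondegenerate conic
(`hasParallelBasis_or_isConic`). An orthonormal basis leads to the first two canonical forms, a
conic to the third. Points of the conic `a c = b²` correspond, up to phase, to real null vectors of
a Lorentz form on `ℝ⁴`. Positivity of their second moments is the parameter inequality
(`moments_inequality`). In the other direction, a factorization of the moment matrix is rotated
until all its vectors are null (`exists_null_decomposition`), and these lift back to a frame on the
conic. -/

namespace EBSpace

open Matrix

/-! ### Entanglement breaking as existence of a parallel frame -/

section Criterion

open scoped ComplexOrder

/-- Contraction of a bipartite vector with `w` on the second factor. -/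
def contr {A B : Type*} [Fintype B] (w : B → ℂ) : (A × B → ℂ) →ₗ[ℂ] (A → ℂ) where
  toFun v i := ∑ b, v (i, b) * w b
  map_add' v v' := by ext i; simp [add_mul, Finset.sum_add_distrib]
  map_smul' r v := by ext i; simp [Finset.mul_sum, mul_assoc]

/-- The contractions of all elements of `V` with `w` lie on a common line. -/
def ParallelAt {A B : Type*} [Fintype B] (V : Submodule ℂ (A × B → ℂ)) (w : B → ℂ) : Prop :=
  ∃ x : A → ℂ, ∀ v ∈ V, ∃ c : ℂ, contr w v = c • x

/-- A decomposition of the identity into rank-one operators at whose vectors `V` contracts to a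
line. -/
def HasParallelFrame {A B : Type*} [Fintype B] [DecidableEq B]
    (V : Submodule ℂ (A × B → ℂ)) : Prop :=
  ∃ (N : ℕ) (u : Fin N → B → ℂ), ∑ n, proj (u n) = 1 ∧ ∀ n, ParallelAt V (u n)

theorem contr_apply {A B : Type*} [Fintype B] (w : B → ℂ) (v : A × B → ℂ) (i : A) :
    contr w v i = ∑ b, v (i, b) * w b :=
  rfl

@[simp]
theorem contr_prodVec {A B : Type*} [Fintype B] (w : B → ℂ) (x : A → ℂ) (y : B → ℂ) :
    contr w (prodVec x y) = (y ⬝ᵥ w) • x := by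
  ext i
  simp only [contr_apply, prodVec, dotProduct, Pi.smul_apply, smul_eq_mul, Finset.sum_mul]
  exact Finset.sum_congr rfl fun b _ => by ring

variable {A B E ι : Type*} [Fintype A] [Fintype B] [Fintype E] [Fintype ι]

theorem isNormalized_iff (ψ : ι → ℂ) : IsNormalized ψ ↔ ∑ i, ‖ψ i‖ ^ 2 = 1 := by
  have h : star ψ ⬝ᵥ ψ = ((∑ i, ‖ψ i‖ ^ 2 : ℝ) : ℂ) := by
    simp [dotProduct, Complex.conj_mul']
  rw [IsNormalized, h]
  exact_mod_cast Iff.rfl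

theorem exists_isNormalized_smul {ψ : ι → ℂ} (h : ψ ≠ 0) :
    0 < ∑ i, ‖ψ i‖ ^ 2 ∧
      IsNormalized ((((√(∑ i, ‖ψ i‖ ^ 2))⁻¹ : ℝ) : ℂ) • ψ) := by
  have hpos : 0 < ∑ i, ‖ψ i‖ ^ 2 := by
    obtain ⟨i, hi⟩ := Function.ne_iff.1 h
    exact Finset.sum_pos' (fun i _ => by positivity)
      ⟨i, Finset.mem_univ i, by have := norm_pos_iff.2 hi; positivity⟩
  refine ⟨hpos, ?_⟩
  rw [isNormalized_iff]
  simp only [Pi.smul_apply, norm_smul, mul_pow, ← Finset.mul_sum, Complex.norm_real, norm_inv,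
    inv_pow, Real.norm_eq_abs, sq_abs, Real.sq_sqrt hpos.le]
  exact inv_mul_cancel₀ hpos.ne'

/-- A Hermitian matrix has a Hermitian generalized inverse commuting with it. -/
theorem exists_generalized_inverse [DecidableEq B] {H : Matrix B B ℂ} (hH : H.IsHermitian) :
    ∃ K : Matrix B B ℂ, Kᴴ = K ∧ K * H = H * K ∧ H * K * H = H := by
  set U : Matrix B B ℂ := (hH.eigenvectorUnitary : Matrix B B ℂ) with hU
  set d : B → ℂ := RCLike.ofReal ∘ hH.eigenvalues with hd
  have hUU : Uᴴ * U = 1 := by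
    simpa [star_eq_conjTranspose] using Unitary.coe_star_mul_self hH.eigenvectorUnitary
  have hspec : H = U * diagonal d * Uᴴ := by
    conv_lhs => rw [hH.spectral_theorem, Unitary.conjStarAlgAut_apply]
    rfl
  have key : ∀ a b : B → ℂ, (U * diagonal a * Uᴴ) * (U * diagonal b * Uᴴ)
      = U * diagonal (fun i => a i * b i) * Uᴴ := fun a b => by
    calc _ = U * diagonal a * (Uᴴ * U) * diagonal b * Uᴴ := by simp only [Matrix.mul_assoc]
      _ = _ := by rw [hUU, Matrix.mul_one, Matrix.mul_assoc U, diagonal_mul_diagonal]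
  -- The convention `0⁻¹ = 0` makes this the pseudo-inverse, with no case split on zero eigenvalues.
  refine ⟨U * diagonal (fun i => (d i)⁻¹) * Uᴴ, ?_, ?_, ?_⟩
  · have : star (fun i => (d i)⁻¹) = fun i => (d i)⁻¹ := by
      ext i; simp [hd]
    simp [Matrix.mul_assoc, this]
  · rw [hspec, key, key]; simp only [mul_comm]
  · rw [hspec, key, key]
    congr 3
    ext i
    exact mul_inv_mul_cancel (d i)

/-- Two factorizations of a positive semidefinite matrix are related by a partial isometry. -/
theorem exists_coisometry [DecidableEq A] [DecidableEq B] {T : Matrix A B ℂ} {F : Matrix A ι ℂ}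
    (h : T * Tᴴ = F * Fᴴ) :
    ∃ (Y : Matrix B ι ℂ) (Z : Matrix B B ℂ), T * Y = F ∧ T * Z = 0 ∧ Y * Yᴴ + Z * Zᴴ = 1 := by
  obtain ⟨K, hK, hc, hi⟩ := exists_generalized_inverse (isHermitian_conjTranspose_mul_self T)
  set H := Tᴴ * T with hH
  have hHH : Hᴴ = H := isHermitian_conjTranspose_mul_self T
  have hTZ : T * (1 - K * H) = 0 := by
    rw [← conjTranspose_mul_self_eq_zero]
    have : Tᴴ * (T * (1 - K * H)) = 0 := by
      rw [← Matrix.mul_assoc, ← hH, Matrix.mul_sub, ← Matrix.mul_assoc, hi]; simp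
    rw [conjTranspose_mul, Matrix.mul_assoc, this, Matrix.mul_zero]
  have hZ : (1 - K * H)ᴴ = 1 - K * H := by
    rw [conjTranspose_sub, conjTranspose_mul, hK, hHH, hc, conjTranspose_one]
  have hPP : K * H * (K * H) = K * H := by
    rw [Matrix.mul_assoc, ← Matrix.mul_assoc H, hi]
  -- `K * H` is the orthogonal projection onto the complement of `ker T`. The first witness
  -- satisfies `Y * Yᴴ = K * H`; the second is the projection onto `ker T`.
  refine ⟨K * Tᴴ * F, 1 - K * H, ?_, hTZ, ?_⟩
  -- The matrix `T * K * Tᴴ - 1` kills `T`, hence `T * Tᴴ = F * Fᴴ`, hence `F`.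
  · have hG : (T * K * Tᴴ - 1) * F = 0 := by
      rw [← self_mul_conjTranspose_eq_zero]
      have : (T * K * Tᴴ - 1) * T = 0 := by
        have e : (T * K * Tᴴ - 1) * T = -(T * (1 - K * H)) := by
          rw [hH]; simp only [Matrix.sub_mul, Matrix.mul_sub, Matrix.mul_assoc]; simp
        rw [e, hTZ, neg_zero]
      calc _ = (T * K * Tᴴ - 1) * (F * Fᴴ) * (T * K * Tᴴ - 1)ᴴ := by
            simp only [conjTranspose_mul, Matrix.mul_assoc]
        _ = (T * K * Tᴴ - 1) * T * Tᴴ * (T * K * Tᴴ - 1)ᴴ := by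
            rw [← h]; simp only [Matrix.mul_assoc]
        _ = 0 := by rw [this]; simp
    rw [Matrix.sub_mul, Matrix.one_mul, sub_eq_zero] at hG
    simpa only [Matrix.mul_assoc] using hG
  · have hY : K * Tᴴ * F * (K * Tᴴ * F)ᴴ = K * H := by
      calc _ = K * Tᴴ * (F * Fᴴ) * T * K := by
            simp only [conjTranspose_mul, conjTranspose_conjTranspose, hK, Matrix.mul_assoc]
        _ = K * H * (H * K) := by rw [← h, hH]; simp only [Matrix.mul_assoc]
        _ = _ := by rw [← hc, hPP]
    rw [hY, hZ, Matrix.sub_mul, Matrix.mul_sub (K * H), Matrix.one_mul, Matrix.mul_one, hPP]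
    simp

theorem traceB_proj {A B E : Type*} [Fintype B] (Ψ : (A × B) × E → ℂ) :
    traceB (proj Ψ) = (of fun (s : A × E) b => Ψ ((s.1, b), s.2)) *
      (of fun (s : A × E) b => Ψ ((s.1, b), s.2))ᴴ := by
  ext s t
  simp [traceB, proj, vecMulVec_apply, Matrix.mul_apply]

theorem proj_mulVec {A B : Type*} [Fintype B] (T : Matrix A B ℂ) (w : B → ℂ) :
    proj (T *ᵥ w) = T * proj w * Tᴴ := by
  rw [proj, proj, mul_vecMulVec, vecMulVec_mul, star_mulVec]

theorem trace_proj {y : ι → ℂ} (hy : IsNormalized y) : (proj y).trace = 1 := by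
  rw [← hy, proj, trace_vecMulVec, dotProduct_comm]

theorem trace_traceB (ρ : Matrix ((A × B) × E) ((A × B) × E) ℂ) :
    (traceB ρ).trace = ρ.trace := by
  simp only [Matrix.trace, Matrix.diag_apply, traceB, of_apply, Fintype.sum_prod_type]
  exact Finset.sum_congr rfl fun a _ => Finset.sum_comm

theorem sum_proj {B ι : Type*} [Fintype ι] (u : ι → B → ℂ) :
    ∑ n, proj (u n) = (of fun b n => u n b) * (of fun b n => u n b)ᴴ := by
  ext s t
  simp [proj, vecMulVec_apply, Matrix.mul_apply, Matrix.sum_apply]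

theorem hasParallelFrame_of_fintype {A B ι : Type*} [Fintype B] [Fintype ι] [DecidableEq B]
    {V : Submodule ℂ (A × B → ℂ)}
    (u : ι → B → ℂ) (h : ∑ n, proj (u n) = 1) (hu : ∀ n, ParallelAt V (u n)) :
    HasParallelFrame V :=
  ⟨Fintype.card ι, fun n => u ((Fintype.equivFin ι).symm n), by
    rw [← h]; exact Equiv.sum_comp (Fintype.equivFin ι).symm (fun n => proj (u n)),
    fun n => hu _⟩

/-- A single test vector suffices: `∑ e, β e ⊗ |e⟩` for a basis `β` of `V`, with `b`
one-dimensional. Contracting it with `w` records the contractions of all `β e` at once, so the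
result is a product vector exactly when these lie on a line. -/
theorem hasParallelFrame_of_isEB [DecidableEq A] [DecidableEq B] {V : Submodule ℂ (A × B → ℂ)}
    (hV : V ≠ ⊥) (h : IsEB V) : HasParallelFrame V := by
  set k := Module.finrank ℂ V
  let β := Module.finBasis ℂ V
  let Ψ₀ : (A × B) × (Fin k × Fin 1) → ℂ := fun p => (β p.2.1 : A × B → ℂ) p.1
  have hΨ₀ : Ψ₀ ∈ tensorFull V (Fin k × Fin 1) := by
    have : Ψ₀ = ∑ e, prodVec (β e : A × B → ℂ) (Pi.single (e, 0) 1) := by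
      ext ⟨s, e, z⟩
      obtain rfl : z = 0 := Subsingleton.elim _ _
      simp [Ψ₀, prodVec, Finset.sum_apply, Pi.single_apply]
    rw [this]
    exact Submodule.sum_mem _ fun e _ => Submodule.subset_span ⟨_, (β e).2, _, rfl⟩
  have hne : Ψ₀ ≠ 0 := by
    intro h0
    have hk : 0 < k := by
      have := Submodule.nontrivial_iff_ne_bot.2 hV
      exact Module.finrank_pos
    apply β.ne_zero ⟨0, hk⟩
    ext s
    exact congrFun h0 (s, (⟨0, hk⟩, 0))
  obtain ⟨hpos, hnorm⟩ := exists_isNormalized_smul hne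
  set r : ℂ := (((√(∑ i, ‖Ψ₀ i‖ ^ 2))⁻¹ : ℝ) : ℂ) with hr
  have hr0 : r ≠ 0 := by
    rw [hr, Complex.ofReal_ne_zero]; exact inv_ne_zero (Real.sqrt_pos.2 hpos).ne'
  obtain ⟨N, q, μ, ν, hq, -, -, -, hρ⟩ :=
    h k 1 _ (Submodule.smul_mem _ r hΨ₀) hnorm
  rw [traceB_proj] at hρ
  set T : Matrix (A × (Fin k × Fin 1)) B ℂ := of fun s b => (r • Ψ₀) ((s.1, b), s.2) with hT
  have hF : T * Tᴴ = (of fun (s : A × (Fin k × Fin 1)) n => (√(q n) : ℂ) * (μ n s.1 * ν n s.2)) *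
      (of fun (s : A × (Fin k × Fin 1)) n => (√(q n) : ℂ) * (μ n s.1 * ν n s.2))ᴴ := by
    rw [hρ]
    ext s t
    simp only [Matrix.sum_apply, Matrix.mul_apply, conjTranspose_apply, of_apply, Matrix.smul_apply,
      kroneckerMap_apply, proj, vecMulVec_apply, Pi.star_apply, smul_eq_mul]
    refine Finset.sum_congr rfl fun n _ => ?_
    have : (q n : ℂ) = (√(q n) : ℂ) * (√(q n) : ℂ) := by
      rw [← Complex.ofReal_mul, Real.mul_self_sqrt (hq n)]
    rw [this]
    simp only [star_mul', RCLike.star_def, Complex.conj_ofReal]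
    ring
  obtain ⟨Y, Z, hY, hZ, hYZ⟩ := exists_coisometry hF
  have hTw : ∀ (w : B → ℂ) (e : Fin k) (i : A),
      (T *ᵥ w) (i, (e, 0)) = r * contr w (β e : A × B → ℂ) i := fun w e i => by
    simp [hT, mulVec, dotProduct, contr_apply, Ψ₀, Finset.mul_sum, mul_assoc]
  have hpar : ∀ (w : B → ℂ) (x : A → ℂ) (c : Fin k → ℂ),
      (∀ e i, (T *ᵥ w) (i, (e, 0)) = c e * x i) → ParallelAt V w := fun w x c hw => by
    refine ⟨x, fun v hv => ?_⟩
    refine ⟨∑ e, β.repr ⟨v, hv⟩ e * (r⁻¹ * c e), ?_⟩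
    have hs : v = ∑ e, β.repr ⟨v, hv⟩ e • (β e : A × B → ℂ) := by
      have := congrArg V.subtype (β.sum_repr ⟨v, hv⟩)
      simpa only [map_sum, map_smul, Submodule.subtype_apply] using this.symm
    conv_lhs => rw [hs]
    ext i
    simp only [map_sum, map_smul, Finset.sum_apply, Pi.smul_apply, smul_eq_mul, Finset.sum_mul]
    refine Finset.sum_congr rfl fun e _ => ?_
    have h1 := hw e i
    rw [hTw] at h1
    rw [mul_assoc, mul_assoc, ← h1, inv_mul_cancel_left₀ hr0]
  -- The frame consists of the columns of `Y`, which `T` sends to the product vectors of the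
  -- separable decomposition, and the columns of `Z`, which `T` kills.
  refine hasParallelFrame_of_fintype (ι := Fin N ⊕ B)
    (Sum.elim (fun n b => Y b n) (fun n b => Z b n)) ?_ ?_
  · rw [Fintype.sum_sum_type]
    simp only [Sum.elim_inl, Sum.elim_inr]
    rw [sum_proj, sum_proj]
    exact hYZ
  · rintro (n | n)
    · refine hpar _ (μ n) (fun e => (√(q n) : ℂ) * ν n (e, 0)) fun e i => ?_
      have := congrFun (congrFun hY (i, (e, 0))) n
      rw [Matrix.mul_apply] at this
      simp only [mulVec, dotProduct, Sum.elim_inl]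
      rw [this]
      simp only [of_apply]
      ring
    · refine hpar _ 0 0 fun e i => ?_
      have := congrFun (congrFun hZ (i, (e, 0))) n
      rw [Matrix.mul_apply] at this
      simp only [mulVec, dotProduct, Sum.elim_inr]
      rw [this]
      simp

theorem exists_nonneg_smul_normalized {j : ι} (x : ι → ℂ) :
    ∃ (r : ℂ) (y : ι → ℂ), IsNormalized y ∧ x = r • y := by
  classical
  by_cases hx : x = 0
  · exact ⟨0, Pi.single j 1, by simp [IsNormalized], by simp [hx]⟩
  · obtain ⟨hpos, hn⟩ := exists_isNormalized_smul hx
    refine ⟨((√(∑ i, ‖x i‖ ^ 2) : ℝ) : ℂ), _, hn, ?_⟩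
    rw [smul_smul, ← Complex.ofReal_mul, mul_inv_cancel₀ (Real.sqrt_pos.2 hpos).ne']
    simp

/-- Viewed as a matrix `T` from `B`, the state satisfies `T * Tᴴ = ∑ n, proj (T *ᵥ u n)`, and each
`T *ᵥ u n` is a product vector because `u n` contracts `V` to a line. -/
theorem isEB_of_hasParallelFrame [DecidableEq B] {V : Submodule ℂ (A × B → ℂ)}
    (h : HasParallelFrame V) : IsEB V := by
  intro p q Ψ hΨ hnorm
  obtain ⟨N, u, hu, hpar⟩ := h
  have hne : Ψ ≠ 0 := by rintro rfl; simp [IsNormalized] at hnorm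
  -- These indices provide unit vectors to use when a factor `x n` or `φ n` is zero.
  obtain ⟨⟨⟨i₀, b₀⟩, e₀⟩, -⟩ := Function.ne_iff.1 hne
  have hprod : ∀ n, ∃ (x : A → ℂ) (φ : Fin p × Fin q → ℂ),
      ∀ i e, ∑ b, Ψ ((i, b), e) * u n b = x i * φ e := by
    intro n
    obtain ⟨x, hx⟩ := hpar n
    refine ⟨x, ?_⟩
    clear hnorm hne
    induction hΨ using Submodule.span_induction with
    | mem Ψ hΨ =>
      obtain ⟨v, hv, φ, rfl⟩ := hΨ
      obtain ⟨c, hc⟩ := hx v hv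
      refine ⟨c • φ, fun i e => ?_⟩
      have := congrFun hc i
      simp only [contr_apply, Pi.smul_apply, smul_eq_mul] at this
      simp only [prodVec, Pi.smul_apply, smul_eq_mul]
      calc _ = (∑ b, v (i, b) * u n b) * φ e := by
            rw [Finset.sum_mul]; exact Finset.sum_congr rfl fun b _ => by ring
        _ = _ := by rw [this]; ring
    | zero => exact ⟨0, by simp⟩
    | add Ψ Ψ' _ _ h h' =>
      obtain ⟨φ, hφ⟩ := h
      obtain ⟨φ', hφ'⟩ := h'
      exact ⟨φ + φ', fun i e => by
        simp [add_mul, Finset.sum_add_distrib, mul_add, hφ, hφ']⟩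
    | smul a Ψ _ h =>
      obtain ⟨φ, hφ⟩ := h
      exact ⟨a • φ, fun i e => by
        simp only [Pi.smul_apply, smul_eq_mul, mul_assoc, ← Finset.mul_sum, hφ]; ring⟩
  choose x φ hxφ using hprod
  choose r y hy hry using fun n => exists_nonneg_smul_normalized (j := i₀) (x n)
  choose s z hz hsz using fun n => exists_nonneg_smul_normalized (j := e₀) (φ n)
  have hρ : traceB (proj Ψ) =
      ∑ n, ((‖r n * s n‖ ^ 2 : ℝ) : ℂ) • (proj (y n) ⊗ₖ proj (z n)) := by
    rw [traceB_proj]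
    set T : Matrix (A × (Fin p × Fin q)) B ℂ := of fun s b => Ψ ((s.1, b), s.2) with hT
    have hTT : T * Tᴴ = ∑ n, proj (T *ᵥ u n) := by
      simp only [proj_mulVec]
      rw [← Matrix.sum_mul, ← Matrix.mul_sum, hu, Matrix.mul_one]
    rw [hTT]
    refine Finset.sum_congr rfl fun n _ => ?_
    ext a b
    have h1 : ∀ a : A × (Fin p × Fin q), (T *ᵥ u n) a = r n * s n * (y n a.1 * z n a.2) := by
      intro a
      have := hxφ n a.1 a.2
      rw [hry, hsz] at this
      simp only [Pi.smul_apply, smul_eq_mul] at this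
      simp only [hT, mulVec, dotProduct, of_apply]
      rw [this]; ring
    simp only [proj, vecMulVec_apply, Pi.star_apply, h1, Matrix.smul_apply, kroneckerMap_apply,
      smul_eq_mul, star_mul']
    push_cast
    rw [← Complex.mul_conj']
    simp only [map_mul, RCLike.star_def]
    ring
  refine ⟨N, fun n => ‖r n * s n‖ ^ 2, y, z, fun n => by positivity, ?_, hy, hz, hρ⟩
  -- The weights sum to 1 because both sides of `hρ` have the same trace and the product states have
  -- trace 1.
  have htr := congrArg Matrix.trace hρ
  rw [trace_traceB, trace_proj hnorm, trace_sum] at htr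
  simp only [trace_smul, trace_kronecker, trace_proj (hy _), trace_proj (hz _), smul_eq_mul,
    mul_one] at htr
  exact_mod_cast htr.symm

theorem isEB_iff [DecidableEq A] [DecidableEq B] {V : Submodule ℂ (A × B → ℂ)} (hV : V ≠ ⊥) :
    IsEB V ↔ HasParallelFrame V :=
  ⟨hasParallelFrame_of_isEB hV, isEB_of_hasParallelFrame⟩

end Criterion

/-! ### Orthogonality forced by a frame, and the dimension three case -/

section Geometry

/-- Two vectors are linearly dependent, expressed by the vanishing of all `2 × 2` minors. -/
def Par {A : Type*} (y z : A → ℂ) : Prop := ∀ a b, y a * z b = y b * z a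

/-- `c` and `w` are dual bases for the bilinear pairing on `ℂ³`. -/
def IsDual (c w : Fin 3 → Fin 3 → ℂ) : Prop := ∀ i j, c i ⬝ᵥ w j = if i = j then 1 else 0

/-- An orthonormal basis of `ℂ³`. -/
abbrev IsOrthonormal (ε : Fin 3 → Fin 3 → ℂ) : Prop := IsDual ε fun i => star (ε i)

/-- `V` contracts to a line at each vector of the conjugate of some orthonormal basis. -/
def HasParallelBasis {A : Type*} (V : Submodule ℂ (A × Fin 3 → ℂ)) : Prop :=
  ∃ ε, IsOrthonormal ε ∧ ∀ k, ParallelAt V (star (ε k))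

variable {A : Type*}

theorem Par.smul_smul {y : A → ℂ} (s t : ℂ) : Par (s • y) (t • y) := fun a b => by
  simp only [Pi.smul_apply, smul_eq_mul]; ring

theorem Par.exists_smul {y z : A → ℂ} (h : Par y z) (hy : y ≠ 0) : ∃ c : ℂ, z = c • y := by
  obtain ⟨a, ha⟩ := Function.ne_iff.1 hy
  refine ⟨z a / y a, funext fun b => ?_⟩
  have := h a b
  simp only [Pi.zero_apply, ne_eq] at ha
  simp only [Pi.smul_apply, smul_eq_mul]
  field_simp
  linear_combination this

theorem Par.exists_relation {y z : A → ℂ} (h : Par y z) :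
    ∃ s t : ℂ, (s ≠ 0 ∨ t ≠ 0) ∧ s • y + t • z = 0 := by
  by_cases hy : y = 0
  · exact ⟨1, 0, by simp, by simp [hy]⟩
  · obtain ⟨c, rfl⟩ := h.exists_smul hy
    exact ⟨-c, 1, by simp, by simp⟩

theorem ParallelAt.par {B : Type*} [Fintype B] {V : Submodule ℂ (A × B → ℂ)} {w : B → ℂ}
    (h : ParallelAt V w) {v v' : A × B → ℂ} (hv : v ∈ V) (hv' : v' ∈ V) :
    Par (contr w v) (contr w v') := by
  obtain ⟨x, hx⟩ := h
  obtain ⟨c, hc⟩ := hx v hv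
  obtain ⟨c', hc'⟩ := hx v' hv'
  rw [hc, hc']
  exact Par.smul_smul c c'

theorem parallelAt_span {B : Type*} [Fintype B] {S : Set (A × B → ℂ)} {w : B → ℂ}
    (h : ∀ v ∈ S, ∀ v' ∈ S, Par (contr w v) (contr w v')) :
    ParallelAt (Submodule.span ℂ S) w := by
  have key : ∃ x : A → ℂ, ∀ v ∈ S, ∃ c : ℂ, contr w v = c • x := by
    by_cases h0 : ∃ v ∈ S, contr w v ≠ 0
    · obtain ⟨v, hv, hne⟩ := h0
      exact ⟨contr w v, fun v' hv' => (h v hv v' hv').exists_smul hne⟩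
    · push Not at h0
      exact ⟨0, fun v hv => ⟨0, by simp [h0 v hv]⟩⟩
  obtain ⟨x, hx⟩ := key
  refine ⟨x, fun v hv => ?_⟩
  induction hv using Submodule.span_induction with
  | mem v hv => exact hx v hv
  | zero => exact ⟨0, by simp⟩
  | add v v' _ _ h h' =>
    obtain ⟨c, hc⟩ := h
    obtain ⟨c', hc'⟩ := h'
    exact ⟨c + c', by rw [map_add, hc, hc', add_smul]⟩
  | smul a v _ h =>
    obtain ⟨c, hc⟩ := h
    exact ⟨a * c, by rw [map_smul, hc, smul_smul]⟩

theorem parseval {ι : Type*} [Fintype ι] {B : Type*} [Fintype B] [DecidableEq B] {u : ι → B → ℂ}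
    (hu : ∑ n, proj (u n) = 1) (a b : B → ℂ) :
    ∑ n, (a ⬝ᵥ u n) * star (b ⬝ᵥ u n) = a ⬝ᵥ star b := by
  have h : a ⬝ᵥ ((∑ n, proj (u n)) *ᵥ star b) = a ⬝ᵥ star b := by rw [hu, one_mulVec]
  rw [← h, Matrix.sum_mulVec, dotProduct_sum]
  refine Finset.sum_congr rfl fun n _ => ?_
  rw [proj, vecMulVec_mulVec, star_dotProduct_star, dotProduct_smul, dotProduct_comm b]
  simp [dotProduct_comm]

/-- Every term of the Parseval sum has a zero factor. This converts conditions at the frame vectors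
into orthogonality of linear forms, which no longer mentions the frame. -/
theorem orthogonal_of_frame {ι : Type*} [Fintype ι] {B : Type*} [Fintype B] [DecidableEq B]
    {u : ι → B → ℂ} (hu : ∑ n, proj (u n) = 1) {a b : B → ℂ}
    (h : ∀ n, (a ⬝ᵥ u n) * (b ⬝ᵥ u n) = 0) : a ⬝ᵥ star b = 0 := by
  rw [← parseval hu]
  refine Finset.sum_eq_zero fun n _ => ?_
  rcases mul_eq_zero.1 (h n) with h | h <;> simp [h]

theorem IsDual.comm {c w : Fin 3 → Fin 3 → ℂ} (h : IsDual c w) (b b' : Fin 3) :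
    ∑ i, w i b * c i b' = if b = b' then 1 else 0 := by
  have h1 : (of c : Matrix (Fin 3) (Fin 3) ℂ) * (of w)ᵀ = 1 := by
    ext i j
    simpa [Matrix.mul_apply, dotProduct, Matrix.one_apply] using h i j
  have h2 := congrArg (fun M : Matrix (Fin 3) (Fin 3) ℂ => M b b') (mul_eq_one_comm.1 h1)
  simpa [Matrix.mul_apply, Matrix.one_apply] using h2

theorem IsDual.eq_sum {c w : Fin 3 → Fin 3 → ℂ} (h : IsDual c w) (v : A × Fin 3 → ℂ) :
    v = ∑ i, prodVec (contr (w i) v) (c i) := by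
  ext ⟨a, b⟩
  have : ∑ b', v (a, b') * (∑ i, w i b' * c i b) = v (a, b) := by simp [h.comm]
  rw [← this]
  simp only [Finset.sum_apply, prodVec, contr_apply, Finset.mul_sum, Finset.sum_mul]
  rw [Finset.sum_comm]
  simp only [mul_assoc]

theorem IsDual.perm {c w : Fin 3 → Fin 3 → ℂ} (h : IsDual c w) (σ : Equiv.Perm (Fin 3)) :
    IsDual (c ∘ σ) (w ∘ σ) := fun i j => by
  simp [h (σ i) (σ j)]

theorem IsDual.ne_zero {c w : Fin 3 → Fin 3 → ℂ} (h : IsDual c w) (i : Fin 3) : c i ≠ 0 := by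
  intro h0
  have := h i i
  simp [h0] at this

/-- A frame of `ℂ³` contains a basis. -/
theorem exists_isDual_of_frame {N : ℕ} {u : Fin N → Fin 3 → ℂ} (hu : ∑ n, proj (u n) = 1) :
    ∃ (c : Fin 3 → Fin 3 → ℂ) (σ : Fin 3 → Fin N), IsDual c fun i => u (σ i) := by
  have hspan : Submodule.span ℂ (Set.range u) = ⊤ := by
    rw [eq_top_iff]
    intro v _
    have : v = ∑ n, (star (u n) ⬝ᵥ v) • u n := by
      conv_lhs => rw [← one_mulVec v, ← hu, Matrix.sum_mulVec]
      simp [proj, vecMulVec_mulVec]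
    rw [this]
    exact Submodule.sum_mem _ fun n _ =>
      Submodule.smul_mem _ _ (Submodule.subset_span (Set.mem_range_self n))
  obtain ⟨κ, a, ha, hs, hli⟩ := exists_linearIndependent' ℂ u
  have : Finite κ := Finite.of_injective a ha
  have := Fintype.ofFinite κ
  have hcard : Fintype.card κ = 3 := by
    have := finrank_span_eq_card hli
    rw [hs, hspan, finrank_top, Module.finrank_fin_fun] at this
    exact this.symm
  let e : Fin 3 ≃ κ := (Fintype.equivFinOfCardEq hcard).symm
  have hli' : LinearIndependent ℂ (fun i => u (a (e i))) := hli.comp e e.injective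
  set M : Matrix (Fin 3) (Fin 3) ℂ := of fun i => u (a (e i)) with hM
  have hM' : IsUnit M := by
    rw [← Matrix.linearIndependent_rows_iff_isUnit]
    exact hli'
  refine ⟨(M⁻¹)ᵀ, fun i => a (e i), fun i j => ?_⟩
  have h1 : M * M⁻¹ = 1 := Matrix.mul_nonsing_inv M ((Matrix.isUnit_iff_isUnit_det M).1 hM')
  have h2 := congrFun (congrFun h1 j) i
  rw [Matrix.mul_apply, Matrix.one_apply] at h2
  simp only [eq_comm (a := i)]
  rw [← h2, dotProduct_comm]
  rfl

/-- Nonzero, pairwise orthogonal vectors extend to an orthonormal basis up to scaling. -/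
theorem exists_isOrthonormal_extension (v : Fin 3 → Fin 3 → ℂ) (s : Set (Fin 3))
    (h0 : ∀ i ∈ s, v i ≠ 0) (h : ∀ i ∈ s, ∀ j ∈ s, i ≠ j → v i ⬝ᵥ star (v j) = 0) :
    ∃ ε, IsOrthonormal ε ∧ ∀ i ∈ s, ∃ t : ℝ, 0 < t ∧ v i = (t : ℂ) • ε i := by
  classical
  let V : Fin 3 → EuclideanSpace ℂ (Fin 3) := fun i => WithLp.toLp 2 (v i)
  let V' : Fin 3 → EuclideanSpace ℂ (Fin 3) := fun i => ((‖V i‖⁻¹ : ℝ) : ℂ) • V i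
  have hin : ∀ i j, inner ℂ (V i) (V j) = v j ⬝ᵥ star (v i) := fun i j => rfl
  have hV0 : ∀ i ∈ s, ‖V i‖ ≠ 0 := fun i hi => by
    rw [norm_ne_zero_iff]
    intro hv
    exact h0 i hi (congrArg WithLp.ofLp hv)
  have hon : Orthonormal ℂ (s.domRestrict V') := by
    constructor
    · rintro ⟨i, hi⟩
      have := hV0 i hi
      simp [V', norm_smul, this]
    · rintro ⟨i, hi⟩ ⟨j, hj⟩ hij
      have : j ≠ i := fun h => hij (by simp [h])
      simp [V', inner_smul_left, inner_smul_right, hin, h j hj i hi this]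
  obtain ⟨b, hb⟩ := Orthonormal.exists_orthonormalBasis_extension_of_card_eq (by simp) hon
  refine ⟨fun i => WithLp.ofLp (b i), fun i j => ?_, fun i hi => ⟨‖V i‖, ?_, ?_⟩⟩
  · have := orthonormal_iff_ite.1 b.orthonormal j i
    simp only [eq_comm (a := i)]
    exact this
  · exact lt_of_le_of_ne (norm_nonneg _) (hV0 i hi).symm
  · have : (‖V i‖ : ℂ) ≠ 0 := by exact_mod_cast hV0 i hi
    beta_reduce
    rw [hb i hi]
    simp only [V', WithLp.ofLp_smul, smul_smul]
    push_cast
    rw [mul_inv_cancel₀ this, one_smul]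

/-- At `k = p` the second factor vanishes by orthogonality of `a` and `b`; at any other `k` the
first does. -/
theorem mul_eq_zero_of_orthogonal {ε : Fin 3 → Fin 3 → ℂ} (hε : IsOrthonormal ε)
    {a b : Fin 3 → ℂ} {p : Fin 3} {t : ℝ} (ht : 0 < t) (ha : a = (t : ℂ) • ε p)
    (hab : a ⬝ᵥ star b = 0) (k : Fin 3) : (a ⬝ᵥ star (ε k)) * (b ⬝ᵥ star (ε k)) = 0 := by
  have ht' : (t : ℂ) ≠ 0 := by exact_mod_cast ht.ne'
  by_cases hk : p = k
  · subst hk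
    have h1 : b ⬝ᵥ star (ε p) = star (ε p ⬝ᵥ star b) := by
      rw [← star_dotProduct_star, star_star, dotProduct_comm]
    rw [ha, smul_dotProduct, smul_eq_mul, mul_eq_zero] at hab
    rw [h1, hab.resolve_left ht', star_zero, mul_zero]
  · rw [ha, smul_dotProduct, hε p k, if_neg hk, smul_zero, zero_mul]

/-- Regard `r` as a graph on three vertices. It suffices that `ε` contain the directions `c i` for
`i` in a vertex cover, and these directions must be mutually orthogonal, so the cover should be a
clique. -/
theorem exists_isOrthonormal_of_conflict {c : Fin 3 → Fin 3 → ℂ} (hc : ∀ i, c i ≠ 0)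
    {r : Fin 3 → Fin 3 → Prop} (h : ∀ i j, i ≠ j → r i j → c i ⬝ᵥ star (c j) = 0)
    (hr : ∀ i j, r i j → r j i) :
    ∃ ε, IsOrthonormal ε ∧ ∀ k i j, i ≠ j → r i j →
      (c i ⬝ᵥ star (ε k)) * (c j ⬝ᵥ star (ε k)) = 0 := by
  -- A complete graph is its own cover. Otherwise some edge is missing, and the vertex opposite to
  -- it meets all the other edges.
  have key : ∃ s : Set (Fin 3), (∀ i ∈ s, ∀ j ∈ s, i ≠ j → r i j) ∧
      ∀ i j, i ≠ j → r i j → i ∈ s ∨ j ∈ s := by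
    by_cases hall : ∀ i j, i ≠ j → r i j
    · exact ⟨Set.univ, fun i _ j _ => hall i j, fun i j _ _ => Or.inl trivial⟩
    · push Not at hall
      obtain ⟨i, j, hij, hrij⟩ := hall
      have hk : ∃ p, p ≠ i ∧ p ≠ j ∧ ∀ q, q = i ∨ q = j ∨ q = p := by
        clear hrij
        revert i j; decide
      obtain ⟨p, -, -, hp⟩ := hk
      refine ⟨{p}, ?_, ?_⟩
      · rintro a rfl b rfl hab
        exact absurd rfl hab
      · intro a b hab hrab
        by_contra! hne
        simp only [Set.mem_singleton_iff] at hne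
        have ha := (or_assoc.2 (hp a)).resolve_right hne.1
        have hb := (or_assoc.2 (hp b)).resolve_right hne.2
        rcases ha with rfl | rfl <;> rcases hb with rfl | rfl
        · exact hab rfl
        · exact hrij hrab
        · exact hrij (hr _ _ hrab)
        · exact hab rfl
  obtain ⟨s, hs, hs'⟩ := key
  obtain ⟨ε, hε, hεs⟩ := exists_isOrthonormal_extension c s (fun i _ => hc i)
    fun i hi j hj hij => h i j hij (hs i hi j hj hij)
  refine ⟨ε, hε, fun k i j hij hrij => ?_⟩
  rcases hs' i j hij hrij with hi | hj
  · obtain ⟨t, ht, hti⟩ := hεs i hi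
    exact mul_eq_zero_of_orthogonal hε ht hti (h i j hij hrij) k
  · obtain ⟨t, ht, htj⟩ := hεs j hj
    rw [mul_comm]
    exact mul_eq_zero_of_orthogonal hε ht htj (h j i hij.symm (hr _ _ hrij)) k

theorem exists_isOrthonormal_of_orthogonal {a b : Fin 3 → ℂ} (ha : a ≠ 0) (h : a ⬝ᵥ star b = 0) :
    ∃ ε, IsOrthonormal ε ∧ ∀ k, (a ⬝ᵥ star (ε k)) * (b ⬝ᵥ star (ε k)) = 0 := by
  obtain ⟨ε, hε, hs⟩ := exists_isOrthonormal_extension (fun _ => a) {0} (fun _ _ => ha)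
    (by rintro i rfl j rfl hij; exact absurd rfl hij)
  obtain ⟨t, ht, hta⟩ := hs 0 rfl
  exact ⟨ε, hε, mul_eq_zero_of_orthogonal hε ht hta h⟩

theorem isOrthonormal_ket : IsOrthonormal fun i => ket i := fun i j => by
  simp [ket, Pi.single_apply, eq_comm]

theorem exists_mem_smul {V : Submodule ℂ (A × Fin 3 → ℂ)} {w : Fin 3 → Fin 3 → ℂ}
    (hw : ∀ i, ParallelAt V (w i)) :
    ∃ x : Fin 3 → A → ℂ, ∀ v ∈ V, ∃ α : Fin 3 → ℂ, ∀ i, contr (w i) v = α i • x i := by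
  choose x hx using hw
  refine ⟨x, fun v hv => ?_⟩
  choose α hα using fun i => hx i v hv
  exact ⟨α, hα⟩

theorem prodVec_smul_left {B : Type*} (s : ℂ) (x : A → ℂ) (y : B → ℂ) :
    prodVec (s • x) y = s • prodVec x y := by
  ext p; simp [prodVec, mul_assoc]

theorem prodVec_smul_right {B : Type*} (s : ℂ) (x : A → ℂ) (y : B → ℂ) :
    prodVec x (s • y) = s • prodVec x y := by
  ext p; simp [prodVec, mul_left_comm]

theorem IsDual.le_span {V : Submodule ℂ (A × Fin 3 → ℂ)} {c w : Fin 3 → Fin 3 → ℂ}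
    (h : IsDual c w) {x : Fin 3 → A → ℂ}
    (hx : ∀ v ∈ V, ∃ α : Fin 3 → ℂ, ∀ i, contr (w i) v = α i • x i) :
    V ≤ Submodule.span ℂ (Set.range fun i => prodVec (x i) (c i)) := by
  intro v hv
  obtain ⟨α, hα⟩ := hx v hv
  rw [h.eq_sum v]
  refine Submodule.sum_mem _ fun i _ => ?_
  rw [hα, prodVec_smul_left]
  exact Submodule.smul_mem _ _ (Submodule.subset_span ⟨i, rfl⟩)

/-- Expanding along the dual of a basis taken from the frame puts `V` inside the span of three
product vectors. -/
theorem finrank_le_three [Fintype A] {V : Submodule ℂ (A × Fin 3 → ℂ)} (h : HasParallelFrame V) :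
    Module.finrank ℂ V ≤ 3 := by
  obtain ⟨N, u, hu, hpar⟩ := h
  obtain ⟨c, σ, hc⟩ := exists_isDual_of_frame hu
  obtain ⟨x, hx⟩ := exists_mem_smul fun i => hpar (σ i)
  refine (Submodule.finrank_mono (hc.le_span hx)).trans ?_
  simpa [Set.finrank] using finrank_range_le_card (R := ℂ) fun i => prodVec (x i) (c i)

theorem IsDual.eq_span [Fintype A] {V : Submodule ℂ (A × Fin 3 → ℂ)} {c w : Fin 3 → Fin 3 → ℂ}
    (h : IsDual c w) {x : Fin 3 → A → ℂ}
    (hx : ∀ v ∈ V, ∃ α : Fin 3 → ℂ, ∀ i, contr (w i) v = α i • x i)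
    (hV : Module.finrank ℂ V = 3) :
    V = Submodule.span ℂ (Set.range fun i => prodVec (x i) (c i)) := by
  refine Submodule.eq_of_le_of_finrank_le (h.le_span hx) ?_
  rw [hV]
  simpa [Set.finrank] using finrank_range_le_card (R := ℂ) fun i => prodVec (x i) (c i)

/-- In dimension 3 each `x i ⊗ c i` itself lies in `V`, so parallelism at a frame vector constrains
every pair separately: two indices conflict when `x i`, `x j` are not parallel. -/
theorem hasParallelBasis_of_finrank_eq_three [Fintype A] {V : Submodule ℂ (A × Fin 3 → ℂ)}
    (h : HasParallelFrame V) (hV : Module.finrank ℂ V = 3) : HasParallelBasis V := by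
  obtain ⟨N, u, hu, hpar⟩ := h
  obtain ⟨c, σ, hc⟩ := exists_isDual_of_frame hu
  obtain ⟨x, hx⟩ := exists_mem_smul fun i => hpar (σ i)
  have hVs := hc.eq_span hx hV
  have hmem : ∀ i, prodVec (x i) (c i) ∈ V := fun i => by
    rw [hVs]; exact Submodule.subset_span ⟨i, rfl⟩
  obtain ⟨ε, hε, hεc⟩ := exists_isOrthonormal_of_conflict hc.ne_zero
    (r := fun i j => ¬ Par (x i) (x j)) (fun i j _ hij => by
      refine orthogonal_of_frame hu fun n => ?_
      by_contra hne
      refine hij fun a b => ?_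
      have := (hpar n).par (hmem i) (hmem j) a b
      simp only [contr_prodVec, Pi.smul_apply, smul_eq_mul] at this
      refine mul_left_cancel₀ hne ?_
      linear_combination this)
    (fun i j hij hji => hij fun a b => by linear_combination -(hji a b))
  refine ⟨ε, hε, fun k => ?_⟩
  rw [hVs]
  refine parallelAt_span ?_
  rintro _ ⟨i, rfl⟩ _ ⟨j, rfl⟩ a b
  simp only [contr_prodVec, Pi.smul_apply, smul_eq_mul]
  by_cases hij : i = j
  · subst hij; ring
  by_cases hp : Par (x i) (x j)
  · linear_combination ((c i ⬝ᵥ star (ε k)) * (c j ⬝ᵥ star (ε k))) * hp a b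
  · linear_combination (x i a * x j b - x i b * x j a) * hεc k i j hij hp

end Geometry

/-! ### Two-dimensional spaces: orthonormal basis or conic -/

section TwoDimensional

variable {A : Type*}

/-- `V` is spanned by a local image of one of the canonical bases. -/
def IsCanonical (V : Submodule ℂ (A × Fin 3 → ℂ)) : Prop :=
  ∃ S : Set (Fin 3 × Fin 3 → ℂ), IsCanonicalBasis S ∧ ∃ W : Matrix A (Fin 3) ℂ,
    ∃ X ∈ Matrix.unitaryGroup (Fin 3) ℂ, V = Submodule.span ℂ (localOp W X '' S)

theorem prodVec_add_right {B : Type*} (x : A → ℂ) (y y' : B → ℂ) :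
    prodVec x (y + y') = prodVec x y + prodVec x y' := by
  ext p; simp [prodVec, mul_add]

theorem localOp_prodVec {A' B B' : Type*} [Fintype A] [Fintype B] (W : Matrix A' A ℂ)
    (X : Matrix B' B ℂ) (x : A → ℂ) (y : B → ℂ) :
    localOp W X (prodVec x y) = prodVec (W *ᵥ x) (X *ᵥ y) := by
  ext ⟨i, j⟩
  simp only [localOp, mulVecLin_apply, mulVec, dotProduct, Fintype.sum_prod_type,
    kroneckerMap_apply, prodVec]
  rw [Finset.sum_mul_sum]
  exact Finset.sum_congr rfl fun a _ => Finset.sum_congr rfl fun b _ => by ring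

theorem mulVec_ket {n : ℕ} (W : Matrix A (Fin n) ℂ) (i : Fin n) : W *ᵥ ket i = Wᵀ i := by
  simp [ket]; rfl

theorem mem_unitaryGroup_of_isOrthonormal {ε : Fin 3 → Fin 3 → ℂ} (hε : IsOrthonormal ε) :
    (of ε)ᵀ ∈ Matrix.unitaryGroup (Fin 3) ℂ := by
  rw [Matrix.mem_unitaryGroup_iff']
  ext i j
  have := hε j i
  rw [dotProduct_comm] at this
  simp only [eq_comm (a := j)] at this
  simpa [Matrix.mul_apply, dotProduct, Matrix.one_apply, star_eq_conjTranspose] using this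

theorem isCanonical_of_eq {V : Submodule ℂ (A × Fin 3 → ℂ)} {S : Set (Fin 3 × Fin 3 → ℂ)}
    (hS : IsCanonicalBasis S) (y : Fin 3 → A → ℂ) {ε : Fin 3 → Fin 3 → ℂ} (hε : IsOrthonormal ε)
    (hV : V = Submodule.span ℂ (localOp (of y)ᵀ (of ε)ᵀ '' S)) : IsCanonical V :=
  ⟨S, hS, _, _, mem_unitaryGroup_of_isOrthonormal hε, hV⟩

theorem localOp_ket (y : Fin 3 → A → ℂ) (ε : Fin 3 → Fin 3 → ℂ) (i j : Fin 3) :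
    localOp (of y)ᵀ (of ε)ᵀ (prodVec (ket i) (ket j)) = prodVec (y i) (ε j) := by
  rw [localOp_prodVec, mulVec_ket, mulVec_ket]; rfl

theorem span_pair_eq {M : Type*} [AddCommGroup M] [Module ℂ M] {v₁ v₂ : M} {a b c d : ℂ}
    (h : a * d - b * c ≠ 0) :
    Submodule.span ℂ {v₁, v₂} = Submodule.span ℂ {a • v₁ + b • v₂, c • v₁ + d • v₂} := by
  set D := a * d - b * c with hD
  apply le_antisymm <;> rw [Submodule.span_le] <;> rintro v (rfl | rfl) <;>
    rw [SetLike.mem_coe, Submodule.mem_span_pair]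
  · refine ⟨d / D, -b / D, ?_⟩
    simp only [smul_add, smul_smul]
    rw [add_add_add_comm, ← add_smul, ← add_smul]
    have h1 : d / D * a + -b / D * c = 1 := by field_simp; rw [hD]; ring
    have h2 : d / D * b + -b / D * d = 0 := by ring
    rw [h1, h2, one_smul, zero_smul, add_zero]
  · refine ⟨-c / D, a / D, ?_⟩
    simp only [smul_add, smul_smul]
    rw [add_add_add_comm, ← add_smul, ← add_smul]
    have h1 : -c / D * a + a / D * c = 0 := by ring
    have h2 : -c / D * b + a / D * d = 1 := by field_simp; rw [hD]; ring
    rw [h1, h2, one_smul, zero_smul, zero_add]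
  · exact ⟨a, b, rfl⟩
  · exact ⟨c, d, rfl⟩

theorem exists_span_pair_of_finrank_eq_two {M : Type*} [AddCommGroup M] [Module ℂ M]
    {V : Submodule ℂ M} (hV : Module.finrank ℂ V = 2) :
    ∃ v₁ v₂ : M, V = Submodule.span ℂ {v₁, v₂} ∧
      ∀ s t : ℂ, s • v₁ + t • v₂ = 0 → s = 0 ∧ t = 0 := by
  have : Module.Finite ℂ V := Module.finite_of_finrank_pos (by omega)
  let b := Module.finBasisOfFinrankEq ℂ V hV
  refine ⟨b 0, b 1, ?_, ?_⟩
  · have h := congrArg (Submodule.map V.subtype) b.span_eq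
    rw [Submodule.map_span, Submodule.map_top, Submodule.range_subtype, ← Set.range_comp] at h
    refine h.symm.trans (congrArg _ ?_)
    ext v
    simp [Fin.exists_fin_two, eq_comm]
  · intro s t hst
    have h := Fintype.linearIndependent_iff.1 b.linearIndependent ![s, t] (by
      apply Subtype.ext
      simpa using hst)
    exact ⟨h 0, h 1⟩

/-- A two-dimensional space inside the span of `x i ⊗ c i` has, up to relabelling, a basis in row
echelon form. -/
theorem exists_pencil {V : Submodule ℂ (A × Fin 3 → ℂ)} (hV : Module.finrank ℂ V = 2)
    {c w : Fin 3 → Fin 3 → ℂ} (h : IsDual c w) {x : Fin 3 → A → ℂ}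
    (hx : ∀ v ∈ V, ∃ α : Fin 3 → ℂ, ∀ i, contr (w i) v = α i • x i) :
    ∃ (σ : Equiv.Perm (Fin 3)) (s t : ℂ), V = Submodule.span ℂ
      {prodVec (x (σ 0)) (c (σ 0)) + s • prodVec (x (σ 2)) (c (σ 2)),
        prodVec (x (σ 1)) (c (σ 1)) + t • prodVec (x (σ 2)) (c (σ 2))} := by
  obtain ⟨v₁, v₂, hspan, hli⟩ := exists_span_pair_of_finrank_eq_two hV
  obtain ⟨α, hα⟩ := hx v₁ (by rw [hspan]; exact Submodule.subset_span (by simp))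
  obtain ⟨β, hβ⟩ := hx v₂ (by rw [hspan]; exact Submodule.subset_span (by simp))
  have hv₁ : v₁ = ∑ i, α i • prodVec (x i) (c i) := by
    rw [h.eq_sum v₁]; simp only [hα, prodVec_smul_left]
  have hv₂ : v₂ = ∑ i, β i • prodVec (x i) (c i) := by
    rw [h.eq_sum v₂]; simp only [hβ, prodVec_smul_left]
  -- If every minor vanished, the coordinate vectors would be dependent, and so would `v₁`, `v₂`.
  have hD : ∃ i j, α i * β j - α j * β i ≠ 0 := by
    by_contra! hD
    obtain ⟨s, t, hst, hrel⟩ := Par.exists_relation (y := α) (z := β)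
      fun i j => sub_eq_zero.1 (hD i j)
    have : s • v₁ + t • v₂ = 0 := by
      rw [hv₁, hv₂, Finset.smul_sum, Finset.smul_sum, ← Finset.sum_add_distrib]
      refine Finset.sum_eq_zero fun i _ => ?_
      rw [smul_smul, smul_smul, ← add_smul]
      have := congrFun hrel i
      simp only [Pi.add_apply, Pi.smul_apply, smul_eq_mul, Pi.zero_apply] at this
      rw [this, zero_smul]
    have := hli s t this
    tauto
  obtain ⟨i, j, hij⟩ := hD
  have hne : i ≠ j := by rintro rfl; simp at hij
  obtain ⟨σ, rfl, rfl⟩ : ∃ σ : Equiv.Perm (Fin 3), σ 0 = i ∧ σ 1 = j := by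
    clear hij
    revert i j; decide
  set D := α (σ 0) * β (σ 1) - α (σ 1) * β (σ 0) with hD
  refine ⟨σ, (β (σ 1) * α (σ 2) - α (σ 1) * β (σ 2)) / D,
    (α (σ 0) * β (σ 2) - β (σ 0) * α (σ 2)) / D, ?_⟩
  have h1 : ∀ γ : Fin 3 → ℂ, ∑ i, γ i • prodVec (x i) (c i) =
      γ (σ 0) • prodVec (x (σ 0)) (c (σ 0)) + γ (σ 1) • prodVec (x (σ 1)) (c (σ 1)) +
        γ (σ 2) • prodVec (x (σ 2)) (c (σ 2)) := fun γ => by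
    rw [← Equiv.sum_comp σ, Fin.sum_univ_three]
  rw [hspan, span_pair_eq (a := β (σ 1) / D) (b := -α (σ 1) / D) (c := -β (σ 0) / D)
    (d := α (σ 0) / D), hv₁, hv₂, h1, h1]
  · congr 1
    congr 1
    · ext p
      simp only [Pi.add_apply, Pi.smul_apply, smul_eq_mul]
      field_simp
      rw [hD]; ring
    · congr 1
      ext p
      simp only [Pi.add_apply, Pi.smul_apply, smul_eq_mul]
      field_simp
      rw [hD]; ring
  · have : β (σ 1) / D * (α (σ 0) / D) - -α (σ 1) / D * (-β (σ 0) / D) = D⁻¹ := by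
      field_simp
      rw [hD]; ring
    rw [this]
    exact inv_ne_zero hij

/-- In echelon form only the vanishing of `s` and `t` matters, since nonzero values are absorbed
into the columns of `W`. If one of them is zero the space has the first canonical form, otherwise
the second, with the shared vector moved to the middle. -/
theorem isCanonical_of_hasParallelBasis {V : Submodule ℂ (A × Fin 3 → ℂ)}
    (hV : Module.finrank ℂ V = 2) (h : HasParallelBasis V) : IsCanonical V := by
  obtain ⟨ε', hε', hpar⟩ := h
  obtain ⟨x', hx'⟩ := exists_mem_smul hpar
  obtain ⟨σ, s, t, hspan⟩ := exists_pencil hV hε' hx'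
  have hε : IsOrthonormal (ε' ∘ σ) := hε'.perm σ
  set ε := ε' ∘ σ with hεdef
  set x := x' ∘ σ with hxdef
  replace hspan : V = Submodule.span ℂ {prodVec (x 0) (ε 0) + s • prodVec (x 2) (ε 2),
    prodVec (x 1) (ε 1) + t • prodVec (x 2) (ε 2)} := hspan
  clear_value ε x
  by_cases hs : s = 0
  · refine isCanonical_of_eq (Or.inl rfl) ![x 0, x 1, t • x 2] hε ?_
    rw [hspan, basis₁, Set.image_pair, map_add, localOp_ket, localOp_ket, localOp_ket]
    simp [hs, prodVec_smul_left]
  by_cases ht : t = 0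
  · refine isCanonical_of_eq (Or.inl rfl) ![x 1, x 0, s • x 2] (hε.perm (Equiv.swap 0 1)) ?_
    rw [hspan, basis₁, Set.image_pair, map_add, localOp_ket, localOp_ket, localOp_ket, Set.pair_comm]
    have h2 : (Equiv.swap 0 1 : Equiv.Perm (Fin 3)) 2 = 2 := by decide
    simp [ht, prodVec_smul_left, h2]
  · refine isCanonical_of_eq (Or.inr (Or.inl rfl)) ![x 0, s • x 2, (s / t) • x 1]
      (hε.perm (Equiv.swap 1 2)) ?_
    rw [hspan, basis₂, Set.image_pair, map_add, map_add, localOp_ket, localOp_ket, localOp_ket,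
      span_pair_eq (a := 1) (b := 0) (c := 0) (d := s / t)]
    · have h0 : (Equiv.swap 1 2 : Equiv.Perm (Fin 3)) 0 = 0 := by decide
      congr 2
      · simp [prodVec_smul_left, h0]
      · congr 1
        simp only [zero_smul, zero_add, smul_add, smul_smul, div_mul_cancel₀ s ht]
        simp [prodVec_smul_left, add_comm]
    · simp [hs, ht]

/-- The space is spanned by `x ⊗ ℓ₀ + x' ⊗ ℓ₁` and `x ⊗ ℓ₁ + x' ⊗ ℓ₂` for independent `ℓ₀, ℓ₁, ℓ₂`,
and the vectors `u n` lie on the conic `ℓ₀ ℓ₂ = ℓ₁²`. -/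
structure IsConic {N : ℕ} (V : Submodule ℂ (A × Fin 3 → ℂ)) (u : Fin N → Fin 3 → ℂ)
    (x x' : A → ℂ) (ℓ₀ ℓ₁ ℓ₂ : Fin 3 → ℂ) : Prop where
  eq_span : V = Submodule.span ℂ {prodVec x ℓ₀ + prodVec x' ℓ₁, prodVec x ℓ₁ + prodVec x' ℓ₂}
  indep : ∀ p q r : ℂ, p • ℓ₀ + q • ℓ₁ + r • ℓ₂ = 0 → p = 0 ∧ q = 0 ∧ r = 0
  conic : ∀ n, (ℓ₀ ⬝ᵥ u n) * (ℓ₂ ⬝ᵥ u n) = (ℓ₁ ⬝ᵥ u n) ^ 2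

/-- A linear relation `g` among `x 0, x 1, x 2` makes the wedges `x 1 ∧ x 2`, `x 2 ∧ x 0`, `x 0 ∧ x
1` proportional to `g 0, g 1, g 2`. The wedge of the two contractions is therefore a multiple of one
quadratic form `q` in `γ`; multiplying by `g i` avoids naming the proportionality factor. -/
theorem wedge_relations {x x' g γ : Fin 3 → ℂ} {s t : ℂ}
    (h : g 0 * x 0 + g 1 * x 1 + g 2 * x 2 = 0) (h' : g 0 * x' 0 + g 1 * x' 1 + g 2 * x' 2 = 0) :
    let W := (γ 0 * x 0 + s * γ 2 * x 2) * (γ 1 * x' 1 + t * γ 2 * x' 2) -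
      (γ 0 * x' 0 + s * γ 2 * x' 2) * (γ 1 * x 1 + t * γ 2 * x 2)
    let q := g 2 * γ 0 * γ 1 - g 1 * t * γ 0 * γ 2 - g 0 * s * γ 1 * γ 2
    g 0 * W = (x 1 * x' 2 - x' 1 * x 2) * q ∧ g 1 * W = (x' 0 * x 2 - x 0 * x' 2) * q ∧
      g 2 * W = (x 0 * x' 1 - x' 0 * x 1) * q := by
  refine ⟨?_, ?_, ?_⟩
  · linear_combination -γ 0 * γ 1 * (x 1 * h' - x' 1 * h) - t * γ 0 * γ 2 * (x 2 * h' - x' 2 * h)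
  · linear_combination γ 0 * γ 1 * (x 0 * h' - x' 0 * h) + s * γ 1 * γ 2 * (x 2 * h' - x' 2 * h)
  · linear_combination t * γ 0 * γ 2 * (x 0 * h' - x' 0 * h)
      - s * γ 1 * γ 2 * (x 1 * h' - x' 1 * h)

/-- Independent `x i` give conflicts between pairs of forms, as in dimension 3. Dependent `x i` give
a single quadratic form `q` vanishing on the frame, unless all `x i` are parallel. If `q` splits
into two linear forms these are orthogonal and yield an orthonormal basis; otherwise `q = 0` is the
conic. -/
theorem hasParallelBasis_or_isConic {V : Submodule ℂ (A × Fin 3 → ℂ)}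
    (hV : Module.finrank ℂ V = 2) {N : ℕ} {u : Fin N → Fin 3 → ℂ} (hu : ∑ n, proj (u n) = 1)
    (hpar : ∀ n, ParallelAt V (u n)) :
    HasParallelBasis V ∨ ∃ x x' ℓ₀ ℓ₁ ℓ₂, IsConic V u x x' ℓ₀ ℓ₁ ℓ₂ := by
  obtain ⟨c', σ', hc'⟩ := exists_isDual_of_frame hu
  obtain ⟨x', hx'⟩ := exists_mem_smul fun i => hpar (σ' i)
  obtain ⟨σ, s, t, hspan⟩ := exists_pencil hV hc' hx'
  have hc := hc'.perm σ
  set c := c' ∘ σ with hcdef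
  set w := (fun i => u (σ' i)) ∘ σ with hwdef
  set x := x' ∘ σ with hxdef
  replace hspan : V = Submodule.span ℂ {prodVec (x 0) (c 0) + s • prodVec (x 2) (c 2),
    prodVec (x 1) (c 1) + t • prodVec (x 2) (c 2)} := hspan
  clear_value c x w
  have hc0 := hc.ne_zero
  have hmem₁ : prodVec (x 0) (c 0) + s • prodVec (x 2) (c 2) ∈ V := by
    rw [hspan]; exact Submodule.subset_span (by simp)
  have hmem₂ : prodVec (x 1) (c 1) + t • prodVec (x 2) (c 2) ∈ V := by
    rw [hspan]; exact Submodule.subset_span (by simp)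
  have hpar₁ : ∀ n, Par ((c 0 ⬝ᵥ u n) • x 0 + (s * (c 2 ⬝ᵥ u n)) • x 2)
      ((c 1 ⬝ᵥ u n) • x 1 + (t * (c 2 ⬝ᵥ u n)) • x 2) := fun n => by
    have := (hpar n).par hmem₁ hmem₂
    simpa only [map_add, map_smul, contr_prodVec, smul_smul] using this
  have hpar₂ : ∀ z, Par ((c 0 ⬝ᵥ z) • x 0 + (s * (c 2 ⬝ᵥ z)) • x 2)
      ((c 1 ⬝ᵥ z) • x 1 + (t * (c 2 ⬝ᵥ z)) • x 2) → ParallelAt V z := fun z hz => by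
    rw [hspan]
    apply parallelAt_span
    rintro _ (rfl | rfl) _ (rfl | rfl) a b
    · ring
    · simpa only [map_add, map_smul, contr_prodVec, smul_smul] using hz a b
    · have := (hz b a).symm
      simp only [map_add, map_smul, contr_prodVec, smul_smul]
      linear_combination -this
    · ring
  by_cases hli : LinearIndependent ℂ x
  · left
    have hmul : ∀ n, (c 0 ⬝ᵥ u n) * (c 1 ⬝ᵥ u n) = 0 ∧ (c 0 ⬝ᵥ u n) * (t * (c 2 ⬝ᵥ u n)) = 0 ∧
        (s * (c 2 ⬝ᵥ u n)) * (c 1 ⬝ᵥ u n) = 0 := by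
      intro n
      obtain ⟨p, q, hpq, hrel⟩ := (hpar₁ n).exists_relation
      have h3 := Fintype.linearIndependent_iff.1 hli
        ![p * (c 0 ⬝ᵥ u n), q * (c 1 ⬝ᵥ u n), p * (s * (c 2 ⬝ᵥ u n)) + q * (t * (c 2 ⬝ᵥ u n))] (by
          rw [← hrel, Fin.sum_univ_three]
          ext a
          simp
          ring)
      have e0 := h3 0
      have e1 := h3 1
      have e2 := h3 2
      simp only [cons_val_zero, cons_val_one, cons_val] at e0 e1 e2
      rcases hpq with hp | hq
      · have e0' := (mul_eq_zero.1 e0).resolve_left hp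
        refine ⟨by rw [e0', zero_mul], by rw [e0', zero_mul], ?_⟩
        refine mul_left_cancel₀ hp ?_
        linear_combination (c 1 ⬝ᵥ u n) * e2 - t * (c 2 ⬝ᵥ u n) * e1
      · have e1' := (mul_eq_zero.1 e1).resolve_left hq
        refine ⟨by rw [e1', mul_zero], ?_, by rw [e1', mul_zero]⟩
        refine mul_left_cancel₀ hq ?_
        linear_combination (c 0 ⬝ᵥ u n) * e2 - s * (c 2 ⬝ᵥ u n) * e0
    -- The Plücker coordinates of the pencil, whose echelon rows are `(1, 0, s)` and `(0, 1, t)`.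
    -- Indices `i`, `j` conflict when `D i j ≠ 0`.
    let D : Fin 3 → Fin 3 → ℂ := fun i j =>
      (![1, 0, s] : Fin 3 → ℂ) i * (![0, 1, t] : Fin 3 → ℂ) j
        - (![1, 0, s] : Fin 3 → ℂ) j * (![0, 1, t] : Fin 3 → ℂ) i
    have hDc : ∀ n i j, D i j * ((c i ⬝ᵥ u n) * (c j ⬝ᵥ u n)) = 0 := by
      intro n i j
      obtain ⟨h01, h02, h12⟩ := hmul n
      fin_cases i <;> fin_cases j <;> simp [D] <;> grind
    obtain ⟨ε, hε, hεc⟩ := exists_isOrthonormal_of_conflict hc0 (r := fun i j => D i j ≠ 0)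
      (fun i j _ hij => orthogonal_of_frame hu fun n =>
        (mul_eq_zero.1 (hDc n i j)).resolve_left hij)
      (fun i j hij h => hij (by simp only [D] at h ⊢; linear_combination -h))
    refine ⟨ε, hε, fun k => hpar₂ _ fun a b => ?_⟩
    have hz : ∀ i j, i ≠ j → D i j * ((c i ⬝ᵥ star (ε k)) * (c j ⬝ᵥ star (ε k))) = 0 := by
      intro i j hij
      by_cases h0 : D i j = 0
      · rw [h0, zero_mul]
      · rw [hεc k i j hij h0, mul_zero]
    have h01 := hz 0 1 (by decide)
    have h02 := hz 0 2 (by decide)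
    have h12 := hz 1 2 (by decide)
    simp [D, -mul_eq_zero] at h01 h02 h12
    simp only [Pi.add_apply, Pi.smul_apply, smul_eq_mul]
    linear_combination (x 0 a * x 1 b - x 0 b * x 1 a) * h01
      + (x 0 a * x 2 b - x 0 b * x 2 a) * h02 - (x 1 a * x 2 b - x 1 b * x 2 a) * h12
  · obtain ⟨g, hg, i₀, hi₀⟩ := Fintype.not_linearIndependent_iff.1 hli
    have hga : ∀ a, g 0 * x 0 a + g 1 * x 1 a + g 2 * x 2 a = 0 := fun a => by
      simpa [Fin.sum_univ_three] using congrFun hg a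
    let q : (Fin 3 → ℂ) → ℂ := fun z => g 2 * (c 0 ⬝ᵥ z) * (c 1 ⬝ᵥ z)
      - g 1 * t * (c 0 ⬝ᵥ z) * (c 2 ⬝ᵥ z) - g 0 * s * (c 1 ⬝ᵥ z) * (c 2 ⬝ᵥ z)
    have hW := fun z a b => wedge_relations (γ := fun i => c i ⬝ᵥ z) (s := s) (t := t)
      (x := fun i => x i a) (x' := fun i => x i b) (hga a) (hga b)
    have hq : ∀ z, q z = 0 → ParallelAt V z := by
      intro z hz
      refine hpar₂ z fun a b => ?_
      obtain ⟨e0, e1, e2⟩ := hW z a b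
      replace hz : g 2 * (c 0 ⬝ᵥ z) * (c 1 ⬝ᵥ z) - g 1 * t * (c 0 ⬝ᵥ z) * (c 2 ⬝ᵥ z)
        - g 0 * s * (c 1 ⬝ᵥ z) * (c 2 ⬝ᵥ z) = 0 := hz
      rw [hz, mul_zero] at e0 e1 e2
      refine sub_eq_zero.1 ((mul_eq_zero.1 (?_ : g i₀ * _ = 0)).resolve_left hi₀)
      fin_cases i₀
      · exact e0
      · exact e1
      · exact e2
    by_cases hxx : ∀ i j, Par (x i) (x j)
    · left
      refine ⟨_, isOrthonormal_ket, fun k => hpar₂ _ fun a b => ?_⟩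
      have h01 := hxx 0 1 a b
      have h02 := hxx 0 2 a b
      have h12 := hxx 1 2 a b
      simp only [Pi.add_apply, Pi.smul_apply, smul_eq_mul]
      linear_combination (c 0 ⬝ᵥ star (ket k)) * (c 1 ⬝ᵥ star (ket k)) * h01
        + (c 0 ⬝ᵥ star (ket k)) * t * (c 2 ⬝ᵥ star (ket k)) * h02
        - s * (c 2 ⬝ᵥ star (ket k)) * (c 1 ⬝ᵥ star (ket k)) * h12
    have hqu : ∀ n, q (u n) = 0 := by
      intro n
      by_contra hne
      have hzero : ∀ a b, x 1 a * x 2 b - x 1 b * x 2 a = 0 ∧ x 0 b * x 2 a - x 0 a * x 2 b = 0 ∧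
          x 0 a * x 1 b - x 0 b * x 1 a = 0 := by
        intro a b
        obtain ⟨e0, e1, e2⟩ := hW (u n) a b
        have hw := sub_eq_zero.2 (hpar₁ n a b)
        simp only [Pi.add_apply, Pi.smul_apply, smul_eq_mul] at hw
        rw [hw, mul_zero] at e0 e1 e2
        exact ⟨(mul_eq_zero.1 e0.symm).resolve_right hne,
          (mul_eq_zero.1 e1.symm).resolve_right hne, (mul_eq_zero.1 e2.symm).resolve_right hne⟩
      apply hxx
      intro i j a b
      obtain ⟨e0, e1, e2⟩ := hzero a b
      fin_cases i <;> fin_cases j <;> grind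
    -- When one of the three coefficients of `q` is zero, the remaining terms share a factor `c i`,
    -- so `q` is a product of two linear forms.
    by_cases h2 : g 2 = 0
    · left
      obtain ⟨ε, hε, hk⟩ := exists_isOrthonormal_of_orthogonal (hc0 2)
        (b := (g 1 * t) • c 0 + (g 0 * s) • c 1)
        (orthogonal_of_frame hu fun n => by
          have := hqu n
          simp only [q, h2] at this
          simp only [add_dotProduct, smul_dotProduct, smul_eq_mul]
          linear_combination -this)
      refine ⟨ε, hε, fun k => hq _ ?_⟩
      have := hk k
      simp only [add_dotProduct, smul_dotProduct, smul_eq_mul] at this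
      simp only [q, h2]
      linear_combination -this
    by_cases h1 : g 1 * t = 0
    · left
      obtain ⟨ε, hε, hk⟩ := exists_isOrthonormal_of_orthogonal (hc0 1)
        (b := g 2 • c 0 - (g 0 * s) • c 2)
        (orthogonal_of_frame hu fun n => by
          have := hqu n
          simp only [q, h1] at this
          simp only [sub_dotProduct, smul_dotProduct, smul_eq_mul]
          linear_combination this)
      refine ⟨ε, hε, fun k => hq _ ?_⟩
      have := hk k
      simp only [sub_dotProduct, smul_dotProduct, smul_eq_mul] at this
      simp only [q, h1]
      linear_combination this
    by_cases h0 : g 0 * s = 0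
    · left
      obtain ⟨ε, hε, hk⟩ := exists_isOrthonormal_of_orthogonal (hc0 0)
        (b := g 2 • c 1 - (g 1 * t) • c 2)
        (orthogonal_of_frame hu fun n => by
          have := hqu n
          simp only [q, h0] at this
          simp only [sub_dotProduct, smul_dotProduct, smul_eq_mul]
          linear_combination this)
      refine ⟨ε, hε, fun k => hq _ ?_⟩
      have := hk k
      simp only [sub_dotProduct, smul_dotProduct, smul_eq_mul] at this
      simp only [q, h0]
      linear_combination this
    right
    rw [mul_eq_zero, not_or] at h1 h0
    obtain ⟨h1, ht⟩ := h1
    obtain ⟨h0, hs⟩ := h0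
    have hx2 : x 2 = (-g 0 / g 2) • x 0 + (-g 1 / g 2) • x 1 := by
      ext a
      simp only [Pi.add_apply, Pi.smul_apply, smul_eq_mul]
      field_simp
      linear_combination hga a
    have hρ : s * g 1 / (t * g 0) ≠ 0 := div_ne_zero (mul_ne_zero hs h1) (mul_ne_zero ht h0)
    -- The forms come from eliminating `x 2` with `hx2`. The second generator is rescaled so that
    -- its coefficient at `x 0` equals that of the first at `x 1`.
    refine ⟨x 0, x 1, c 0 + (-s * g 0 / g 2) • c 2, (-s * g 1 / g 2) • c 2,
      (s * g 1 / (t * g 0)) • (c 1 + (-t * g 1 / g 2) • c 2), ?_, ?_, ?_⟩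
    · rw [hspan, span_pair_eq (a := 1) (b := 0) (c := 0) (d := s * g 1 / (t * g 0)) (by simpa using hρ)]
      congr 1
      congr 1
      · ext p
        simp only [hx2, prodVec, Pi.add_apply, Pi.smul_apply, smul_eq_mul]
        field_simp
        ring
      · congr 1
        ext p
        simp only [hx2, prodVec, Pi.add_apply, Pi.smul_apply, smul_eq_mul]
        field_simp
        ring
    · intro p r r' hrel
      have hw : ∀ j, p * ((c 0 ⬝ᵥ w j) + (-s * g 0 / g 2) * (c 2 ⬝ᵥ w j)) +
          r * ((-s * g 1 / g 2) * (c 2 ⬝ᵥ w j)) +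
          r' * ((s * g 1 / (t * g 0)) * ((c 1 ⬝ᵥ w j) + (-t * g 1 / g 2) * (c 2 ⬝ᵥ w j))) = 0 := by
        intro j
        have := congrArg (fun ℓ => ℓ ⬝ᵥ w j) hrel
        simpa only [add_dotProduct, smul_dotProduct, smul_eq_mul, zero_dotProduct] using this
      have w0 := hw 0
      have w1 := hw 1
      have w2 := hw 2
      have hcw : ∀ i j, c i ⬝ᵥ w j = if i = j then 1 else 0 := hc
      simp only [hcw] at w0 w1 w2
      simp [hs, ht, h0, h1] at w0 w1
      simp [w0, w1, hs, h1, h2] at w2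
      exact ⟨w0, w2, w1⟩
    · intro n
      have := hqu n
      simp only [q] at this
      simp only [add_dotProduct, smul_dotProduct, smul_eq_mul]
      field_simp
      linear_combination g 2 * this

end TwoDimensional

/-! ### Normal form of the conic and necessity of the inequality -/

section Conic

variable {A : Type*} {N : ℕ} {V : Submodule ℂ (A × Fin 3 → ℂ)} {u : Fin N → Fin 3 → ℂ}
  {x x' : A → ℂ} {ℓ₀ ℓ₁ ℓ₂ : Fin 3 → ℂ}

/-- The translation `t ↦ t + b` of the parametrization `(1, t, t²)` of the conic. It replaces the
second generator by itself plus `b` times the first. -/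
theorem IsConic.shift (h : IsConic V u x x' ℓ₀ ℓ₁ ℓ₂) (b : ℂ) :
    IsConic V u (x - b • x') x' ℓ₀ (ℓ₁ + b • ℓ₀) (ℓ₂ + (2 * b) • ℓ₁ + b ^ 2 • ℓ₀) where
  eq_span := by
    rw [h.eq_span, span_pair_eq (a := 1) (b := 0) (c := b) (d := 1) (by simp)]
    congr 1
    congr 1
    · ext p
      simp only [prodVec, Pi.add_apply, Pi.sub_apply, Pi.smul_apply, smul_eq_mul]
      ring
    · congr 1
      ext p
      simp only [prodVec, Pi.add_apply, Pi.sub_apply, Pi.smul_apply, smul_eq_mul]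
      ring
  indep p q r hrel := by
    obtain ⟨h0, h1, h2⟩ := h.indep (p + q * b + r * b ^ 2) (q + r * (2 * b)) r (by
      rw [← hrel]; module)
    subst h2
    have hq : q = 0 := by simpa using h1
    subst hq
    exact ⟨by simpa using h0, rfl, rfl⟩
  conic n := by
    have := h.conic n
    simp only [add_dotProduct, smul_dotProduct, smul_eq_mul]
    linear_combination this

theorem IsConic.scale (h : IsConic V u x x' ℓ₀ ℓ₁ ℓ₂) {τ a : ℂ} (hτ : τ ≠ 0) (ha : a ≠ 0) :
    IsConic V u (τ⁻¹ • x) ((τ * a)⁻¹ • x') (τ • ℓ₀) ((τ * a) • ℓ₁) ((τ * a ^ 2) • ℓ₂) where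
  eq_span := by
    rw [h.eq_span, span_pair_eq (a := 1) (b := 0) (c := 0) (d := a) (by simpa)]
    congr 1
    congr 1
    · ext p
      simp only [prodVec, Pi.add_apply, Pi.smul_apply, smul_eq_mul]
      field_simp
      ring
    · congr 1
      ext p
      simp only [prodVec, Pi.add_apply, Pi.smul_apply, smul_eq_mul]
      field_simp
      ring
  indep p q r hrel := by
    have := h.indep (p * τ) (q * (τ * a)) (r * (τ * a ^ 2)) (by rw [← hrel]; module)
    simpa [hτ, ha] using this
  conic n := by
    have := h.conic n
    simp only [smul_dotProduct, smul_eq_mul]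
    linear_combination (τ * a) ^ 2 * this

theorem exists_norm_sq {ι : Type*} [Fintype ι] {ℓ : ι → ℂ} (h : ℓ ≠ 0) :
    ∃ n : ℝ, 0 < n ∧ ℓ ⬝ᵥ star ℓ = (n : ℂ) ^ 2 := by
  obtain ⟨hpos, -⟩ := exists_isNormalized_smul h
  refine ⟨√(∑ i, ‖ℓ i‖ ^ 2), Real.sqrt_pos.2 hpos, ?_⟩
  rw [← Complex.ofReal_pow, Real.sq_sqrt hpos.le]
  simp [dotProduct, Complex.mul_conj']

theorem star_dotProduct_comm {ι : Type*} [Fintype ι] (a b : ι → ℂ) :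
    star (a ⬝ᵥ star b) = b ⬝ᵥ star a := by
  rw [← star_dotProduct_star, star_star, dotProduct_comm]

theorem exists_phase (z : ℂ) : ∃ ζ : ℂ, star ζ * ζ = 1 ∧ ζ ^ 2 * z = (‖z‖ : ℂ) := by
  refine ⟨Complex.exp (((-(z.arg / 2) : ℝ) : ℂ) * Complex.I), ?_, ?_⟩
  · rw [RCLike.star_def, Complex.conj_mul', Complex.norm_exp_ofReal_mul_I]; simp
  · have hz := Complex.norm_mul_exp_arg_mul_I z
    rw [← Complex.exp_nat_mul]
    conv_lhs =>
      enter [2]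
      rw [← hz]
    rw [mul_left_comm, ← Complex.exp_add]
    have : ((2 : ℕ) : ℂ) * (((-(z.arg / 2) : ℝ) : ℂ) * Complex.I) + z.arg * Complex.I = 0 := by
      push_cast; ring
    rw [this]; simp

/-- A shift makes the second form orthogonal to the first, as in Gram–Schmidt. Scaling has two free
parameters: their moduli normalize both forms, and the remaining phase makes `k₂ ⬝ᵥ star k₀` real
and nonnegative. -/
theorem IsConic.exists_normal (h : IsConic V u x x' ℓ₀ ℓ₁ ℓ₂) :
    ∃ (y y' : A → ℂ) (k₀ k₁ k₂ : Fin 3 → ℂ) (d : ℝ), IsConic V u y y' k₀ k₁ k₂ ∧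
      k₀ ⬝ᵥ star k₀ = 1 ∧ k₁ ⬝ᵥ star k₁ = 1 ∧ k₁ ⬝ᵥ star k₀ = 0 ∧ 0 ≤ d ∧
      k₂ ⬝ᵥ star k₀ = d := by
  have hℓ₀ : ℓ₀ ≠ 0 := by
    rintro rfl
    simpa using (h.indep 1 0 0 (by simp)).1
  obtain ⟨n₀, hn₀, e₀⟩ := exists_norm_sq hℓ₀
  have hn₀' : (n₀ : ℂ) ≠ 0 := by exact_mod_cast hn₀.ne'
  set b : ℂ := -(ℓ₁ ⬝ᵥ star ℓ₀) / (n₀ : ℂ) ^ 2 with hb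
  have h' := h.shift b
  set m₁ := ℓ₁ + b • ℓ₀ with hm₁def
  set m₂ := ℓ₂ + (2 * b) • ℓ₁ + b ^ 2 • ℓ₀
  have horth : m₁ ⬝ᵥ star ℓ₀ = 0 := by
    rw [hm₁def, add_dotProduct, smul_dotProduct, e₀, smul_eq_mul, hb]
    field_simp
    ring
  clear_value m₁ m₂
  have hm₁ : m₁ ≠ 0 := by
    rintro rfl
    simpa using (h'.indep 0 1 0 (by simp)).2.1
  obtain ⟨n₁, hn₁, e₁⟩ := exists_norm_sq hm₁
  have hn₁' : (n₁ : ℂ) ≠ 0 := by exact_mod_cast hn₁.ne'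
  obtain ⟨ζ, hζ, hζz⟩ := exists_phase (m₂ ⬝ᵥ star ℓ₀)
  have hζ0 : ζ ≠ 0 := by rintro rfl; simp at hζ
  refine ⟨_, _, _, _, _, ‖m₂ ⬝ᵥ star ℓ₀‖ / n₁ ^ 2,
    h'.scale (τ := ((n₀⁻¹ : ℝ) : ℂ)) (a := ((n₀ / n₁ : ℝ) : ℂ) * ζ) ?_ ?_, ?_, ?_, ?_, ?_, ?_⟩
  · simpa using hn₀.ne'
  · simp [hn₀.ne', hn₁.ne', hζ0]
  · rw [star_smul, smul_dotProduct, dotProduct_smul, e₀]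
    simp only [RCLike.star_def, Complex.conj_ofReal, smul_eq_mul]
    push_cast
    field_simp
  · rw [star_smul, smul_dotProduct, dotProduct_smul, e₁]
    simp only [RCLike.star_def, Complex.conj_ofReal, smul_eq_mul, star_mul'] at hζ ⊢
    push_cast
    field_simp
    linear_combination hζ
  · rw [star_smul, smul_dotProduct, dotProduct_smul, horth]
    simp
  · positivity
  · rw [star_smul, smul_dotProduct, dotProduct_smul]
    simp only [RCLike.star_def, Complex.conj_ofReal, smul_eq_mul]
    push_cast
    field_simp
    linear_combination hζz

/-- A point of the conic `a c = b²` gives a null vector of the Lorentz form. -/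
theorem exists_null_vector {a b c : ℂ} (h : a * c = b ^ 2) :
    ∃ (p s : ℝ) (z : ℂ), a * star a = p ^ 2 ∧ b * star a = p * z ∧ b * star b = p * s ∧
      c * star a = z ^ 2 ∧ c * star b = z * s ∧ c * star c = s ^ 2 ∧
      b * star b = z * star z := by
  have hbb : b * star b = ‖a‖ * ‖c‖ := by
    have : ‖b‖ ^ 2 = ‖a‖ * ‖c‖ := by rw [← norm_pow, ← h, norm_mul]
    rw [RCLike.star_def, Complex.mul_conj', ← Complex.ofReal_pow, this]
    push_cast; rfl
  have haa : a * star a = (‖a‖ : ℂ) ^ 2 := Complex.mul_conj' a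
  have hcc : c * star c = (‖c‖ : ℂ) ^ 2 := Complex.mul_conj' c
  by_cases ha : a = 0
  · subst ha
    have hb : b = 0 := by simpa using h.symm
    subst hb
    exact ⟨0, ‖c‖, 0, by simp, by simp, by simp, by simp, by simp, hcc, by simp⟩
  · have hn : (‖a‖ : ℂ) ≠ 0 := by simpa using ha
    -- The overall phase is fixed so that `a` becomes `‖a‖`; then `b` becomes `z`.
    refine ⟨‖a‖, ‖c‖, b * star a / ‖a‖, haa, by field_simp, hbb, ?_, ?_, hcc, ?_⟩
    · field_simp
      linear_combination (-c * star a) * haa + star a ^ 2 * h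
    · rw [div_mul_eq_mul_div, eq_div_iff hn]
      refine mul_left_cancel₀ ha ?_
      linear_combination (‖a‖ * star b) * h + ‖a‖ * b * hbb - b * ‖c‖ * haa
    · have : star (b * star a / (‖a‖ : ℂ)) = star b * a / ‖a‖ := by
        rw [star_div₀, star_mul', star_star]
        congr 1
        exact Complex.conj_ofReal _
      rw [this]
      field_simp
      linear_combination (-b * star b) * haa

/-- The quadratic in `μ`, `ν` is evaluated at its minimum `(P / A, Q / B)`. When `B = 0`, the bound
`hQ` forces `Q = 0`. -/
theorem admissibility_of_moments {A B P Q h : ℝ} (hA : 0 < A) (hB : 0 ≤ B) (hQ : Q ^ 2 ≤ B * h)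
    (hpos : ∀ μ ν : ℝ, 0 ≤ h - 1 - 2 * μ * P - 2 * ν * Q + μ ^ 2 * A + ν ^ 2 * B) :
    0 ≤ (h - 1) * A * B - B * P ^ 2 - A * Q ^ 2 := by
  rcases hB.eq_or_lt with rfl | hB
  · have : Q = 0 := by
      rw [zero_mul] at hQ
      exact pow_eq_zero_iff two_ne_zero |>.1 (le_antisymm hQ (sq_nonneg Q))
    simp [this]
  · have h1 := mul_nonneg (mul_pos hA hB).le (hpos (P / A) (Q / B))
    have h2 : A * B * (h - 1 - 2 * (P / A) * P - 2 * (Q / B) * Q + (P / A) ^ 2 * A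
        + (Q / B) ^ 2 * B) = (h - 1) * A * B - B * P ^ 2 - A * Q ^ 2 := by
      field_simp
      ring
    rwa [h2] at h1

/-- By Parseval, the inner products of the forms are the second moments of the null vectors `(p, Re
z, Im z, s)`. The conic condition determines `‖ℓ₁ ⬝ᵥ u n‖²` both as `p s` and as `|z|²`, which fixes
every entry of the real moment matrix. Its positivity is tested on `s - p - μ Re z - ν Im z`. -/
theorem moments_inequality (hu : ∑ n, proj (u n) = 1)
    (hconic : ∀ n, (ℓ₀ ⬝ᵥ u n) * (ℓ₂ ⬝ᵥ u n) = (ℓ₁ ⬝ᵥ u n) ^ 2)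
    (h00 : ℓ₀ ⬝ᵥ star ℓ₀ = 1) (h11 : ℓ₁ ⬝ᵥ star ℓ₁ = 1) (h10 : ℓ₁ ⬝ᵥ star ℓ₀ = 0) {d h : ℝ}
    (hd : 0 ≤ d) (h20 : ℓ₂ ⬝ᵥ star ℓ₀ = d) {κ : ℂ} (h21 : ℓ₂ ⬝ᵥ star ℓ₁ = κ)
    (h22 : ℓ₂ ⬝ᵥ star ℓ₂ = h) :
    0 ≤ (h - 1) * ((1 + d) / 2) * ((1 - d) / 2) - (1 - d) / 2 * κ.re ^ 2
      - (1 + d) / 2 * κ.im ^ 2 := by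
  choose p s z e00 e10 e11 e20 e21 e22 ezz using fun n => exists_null_vector (hconic n)
  rw [← parseval hu] at h00 h11 h10 h20 h21 h22
  have h11' := h11
  simp only [e00, e10, e20, e21, e22] at h00 h10 h20 h21 h22
  simp only [e11] at h11
  simp only [ezz] at h11'
  have hp : ∑ n, p n ^ 2 = 1 := by exact_mod_cast h00
  have hs : ∑ n, s n ^ 2 = h := by exact_mod_cast h22
  have hps : ∑ n, p n * s n = 1 := by exact_mod_cast h11
  have hpx : ∑ n, p n * (z n).re = 0 := by simpa using congrArg Complex.re h10
  have hpy : ∑ n, p n * (z n).im = 0 := by simpa using congrArg Complex.im h10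
  have hsx : ∑ n, (z n).re * s n = κ.re := by simpa using congrArg Complex.re h21
  have hsy : ∑ n, (z n).im * s n = κ.im := by simpa using congrArg Complex.im h21
  have hxy2 : ∑ n, ((z n).re * (z n).im + (z n).im * (z n).re) = 0 := by
    simpa [sq] using congrArg Complex.im h20
  have hxxyy : ∑ n, ((z n).re * (z n).re - (z n).im * (z n).im) = d := by
    simpa [sq] using congrArg Complex.re h20
  have hxxpyy : ∑ n, ((z n).re * (z n).re + (z n).im * (z n).im) = 1 := by
    simpa using congrArg Complex.re h11'
  rw [Finset.sum_sub_distrib] at hxxyy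
  rw [Finset.sum_add_distrib] at hxxpyy
  have hx : ∑ n, (z n).re ^ 2 = (1 + d) / 2 := by simp only [sq]; linarith
  have hy : ∑ n, (z n).im ^ 2 = (1 - d) / 2 := by simp only [sq]; linarith
  have hxy : ∑ n, (z n).re * (z n).im = 0 := by
    rw [Finset.sum_add_distrib] at hxy2
    simp only [mul_comm (z _).im] at hxy2
    linarith
  refine admissibility_of_moments (by positivity) ?_ ?_ fun μ ν => ?_
  · rw [← hy]; positivity
  · rw [← hsy, ← hy, ← hs]; exact Finset.sum_mul_sq_le_sq_mul_sq _ _ _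
  · have : ∑ n, (s n - p n - μ * (z n).re - ν * (z n).im) ^ 2 = (∑ n, s n ^ 2) + (∑ n, p n ^ 2)
        + μ ^ 2 * (∑ n, (z n).re ^ 2) + ν ^ 2 * (∑ n, (z n).im ^ 2) - 2 * (∑ n, p n * s n)
        - 2 * μ * (∑ n, (z n).re * s n) - 2 * ν * (∑ n, (z n).im * s n)
        + 2 * μ * (∑ n, p n * (z n).re) + 2 * ν * (∑ n, p n * (z n).im)
        + 2 * μ * ν * (∑ n, (z n).re * (z n).im) := by
      simp only [Finset.mul_sum, ← Finset.sum_add_distrib, ← Finset.sum_sub_distrib]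
      exact Finset.sum_congr rfl fun n _ => by ring
    rw [hs, hp, hx, hy, hps, hsx, hsy, hpx, hpy, hxy] at this
    have h0 : 0 ≤ ∑ n, (s n - p n - μ * (z n).re - ν * (z n).im) ^ 2 := by positivity
    linarith

theorem exists_nonneg_arg (κ : ℂ) :
    ∃ f θ : ℝ, 0 ≤ f ∧ 0 ≤ θ ∧ (f : ℂ) * Complex.exp (Complex.I * θ) = κ := by
  -- The principal argument may be negative; adding `2π` gives `0 ≤ θ`.
  refine ⟨‖κ‖, κ.arg + 2 * Real.pi, norm_nonneg _, ?_, ?_⟩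
  · linarith [Complex.neg_pi_lt_arg κ, Real.pi_pos]
  · conv_rhs => rw [← Complex.norm_mul_exp_arg_mul_I κ]
    have : Complex.I * ((κ.arg + 2 * Real.pi : ℝ) : ℂ)
        = κ.arg * Complex.I + 2 * Real.pi * Complex.I := by push_cast; ring
    rw [this, Complex.exp_add, Complex.exp_two_pi_mul_I, mul_one]

theorem moments_polynomial_eq (d f g θ : ℝ) :
    4 * ((d ^ 2 + f ^ 2 + g ^ 2 - 1) * ((1 + d) / 2) * ((1 - d) / 2)
      - (1 - d) / 2 * (f * Real.cos θ) ^ 2 - (1 + d) / 2 * (f * Real.sin θ) ^ 2) =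
    -1 - f ^ 2 + g ^ 2 - d ^ 2 * (-2 + d ^ 2 + f ^ 2 + g ^ 2)
      + 2 * d * f ^ 2 * Real.cos (2 * θ) := by
  rw [Real.cos_two_mul, mul_pow f (Real.sin θ), Real.sin_sq]
  ring

theorem polar_re_im (f θ : ℝ) : ((f : ℂ) * Complex.exp (Complex.I * θ)).re = f * Real.cos θ ∧
    ((f : ℂ) * Complex.exp (Complex.I * θ)).im = f * Real.sin θ := by
  rw [mul_comm Complex.I]
  simp [Complex.exp_ofReal_mul_I_re, Complex.exp_ofReal_mul_I_im]

/-- The parameters are the coordinates of `k₂` in the orthonormal basis completed from `k₀`, `k₁`: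
`d` along `k₀`, `κ = f e^{iθ}` along `k₁`, and `g`, the norm of the remainder `r`. -/
theorem IsConic.isCanonical (h : IsConic V u x x' ℓ₀ ℓ₁ ℓ₂) (hu : ∑ n, proj (u n) = 1) :
    IsCanonical V := by
  obtain ⟨y, y', k₀, k₁, k₂, d, hk, h00, h11, h10, hd, h20⟩ := h.exists_normal
  obtain ⟨f, θ, hf, hθ, hκ⟩ := exists_nonneg_arg (k₂ ⬝ᵥ star k₁)
  set κ := k₂ ⬝ᵥ star k₁ with hκdef
  set r := k₂ - (d : ℂ) • k₀ - κ • k₁ with hr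
  have h01 : k₀ ⬝ᵥ star k₁ = 0 := by rw [← star_dotProduct_comm, h10, star_zero]
  have hr0 : r ≠ 0 := by
    intro h0
    have := (hk.indep (-d) (-κ) 1 (by rw [← h0, hr]; module)).2.2
    exact one_ne_zero this
  have hrk₀ : r ⬝ᵥ star k₀ = 0 := by
    rw [hr, sub_dotProduct, sub_dotProduct, smul_dotProduct, smul_dotProduct, h20, h00, h10]
    simp
  have hrk₁ : r ⬝ᵥ star k₁ = 0 := by
    rw [hr, sub_dotProduct, sub_dotProduct, smul_dotProduct, smul_dotProduct, ← hκdef, h11, h01]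
    simp
  obtain ⟨g, hg, hgr⟩ := exists_norm_sq hr0
  have hg' : (g : ℂ) ≠ 0 := by exact_mod_cast hg.ne'
  have hk₂ : k₂ = (d : ℂ) • k₀ + κ • k₁ + r := by rw [hr]; module
  have hk₀r : k₀ ⬝ᵥ star r = 0 := by rw [← star_dotProduct_comm, hrk₀, star_zero]
  have hk₁r : k₁ ⬝ᵥ star r = 0 := by rw [← star_dotProduct_comm, hrk₁, star_zero]
  clear_value r
  have h22 : k₂ ⬝ᵥ star k₂ = ((d ^ 2 + f ^ 2 + g ^ 2 : ℝ) : ℂ) := by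
    have hκκ : κ * star κ = (f : ℂ) ^ 2 := by
      rw [RCLike.star_def, Complex.mul_conj', ← hκ, norm_mul, mul_comm Complex.I,
        Complex.norm_exp_ofReal_mul_I]
      simp [abs_of_nonneg hf]
    have hκκ' : κ * (starRingEnd ℂ) κ = (f : ℂ) ^ 2 := hκκ
    clear_value κ
    subst hk₂
    simp only [star_add, star_smul, add_dotProduct, dotProduct_add, smul_dotProduct,
      dotProduct_smul, h00, h11, h10, h01, hrk₀, hrk₁, hk₀r, hk₁r, hgr, smul_eq_mul,
      RCLike.star_def, Complex.conj_ofReal]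
    push_cast
    linear_combination hκκ'
  have hadm := moments_inequality hu hk.conic h00 h11 h10 hd h20 hκdef.symm h22
  obtain ⟨hre, him⟩ := polar_re_im f θ
  rw [hκ] at hre him
  rw [hre, him] at hadm
  refine isCanonical_of_eq (ε := ![k₀, k₁, (g : ℂ)⁻¹ • r])
    (Or.inr (Or.inr ⟨d, f, g, θ, ⟨hg, hd, hf, hθ, ?_⟩, rfl⟩)) ![y, y', 0] ?_ ?_
  · rw [← moments_polynomial_eq]; positivity
  · intro i j
    fin_cases i <;> fin_cases j <;>
      simp [h00, h11, h10, h01, hrk₀, hrk₁, hk₀r, hk₁r, hgr, star_smul, hg', sq]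
  · rw [hk.eq_span, basis₃, Set.image_pair, map_add, map_add, prodVec_add_right,
      prodVec_add_right, prodVec_smul_right, prodVec_smul_right, prodVec_smul_right, hκ]
    simp only [map_add, map_smul, localOp_ket]
    congr 3
    conv_lhs => rw [hk₂]
    simp [prodVec_smul_right, prodVec_add_right, hg', smul_smul, -Complex.coe_smul]

theorem isCanonical_of_hasParallelFrame (hV : Module.finrank ℂ V = 2) (h : HasParallelFrame V) :
    IsCanonical V := by
  obtain ⟨N, u, hu, hpar⟩ := h
  rcases hasParallelBasis_or_isConic hV hu hpar with h | ⟨_, _, _, _, _, h⟩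
  · exact isCanonical_of_hasParallelBasis hV h
  · exact h.isCanonical hu

end Conic

/-! ### Sufficiency of the inequality: constructing a frame on the conic -/

section Existence

/-- The Lorentz form on `ℝ⁴`. -/
def lorentz (v : Fin 4 → ℝ) : ℝ := v 1 ^ 2 + v 2 ^ 2 - v 0 * v 3

/-- An orthogonal mixing of `p` and `q` preserves the sum of their outer products. Along `p + t q`
the Lorentz form is a quadratic in `t` with opposite signs at its ends, so it has a real root; if
`q` is already null, swapping suffices. -/
theorem exists_null_rotation {p q : Fin 4 → ℝ} (hp : lorentz p ≤ 0) (hq : 0 ≤ lorentz q) :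
    ∃ p' q' : Fin 4 → ℝ, lorentz p' = 0 ∧ lorentz q' = lorentz p + lorentz q ∧
      ∀ i j, p' i * p' j + q' i * q' j = p i * p j + q i * q j := by
  suffices h : ∃ p' q' : Fin 4 → ℝ, lorentz p' = 0 ∧
      ∀ i j, p' i * p' j + q' i * q' j = p i * p j + q i * q j by
    obtain ⟨p', q', h0, h⟩ := h
    refine ⟨p', q', h0, ?_, h⟩
    have h11 := h 1 1
    have h22 := h 2 2
    have h03 := h 0 3
    simp only [lorentz] at h0 ⊢
    linear_combination h11 + h22 - h03 - h0
  rcases hq.eq_or_lt with hq | hq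
  · exact ⟨q, p, hq.symm, fun i j => add_comm _ _⟩
  · set b := p 1 * q 1 + p 2 * q 2 - (p 0 * q 3 + p 3 * q 0) / 2 with hb
    have hdisc : 0 ≤ b ^ 2 - lorentz p * lorentz q := by nlinarith [sq_nonneg b]
    set t := (-b + √(b ^ 2 - lorentz p * lorentz q)) / lorentz q with ht
    have hroot : lorentz p + 2 * t * b + t ^ 2 * lorentz q = 0 := by
      have h1 : t * lorentz q + b = √(b ^ 2 - lorentz p * lorentz q) := by
        rw [ht]; field_simp; ring
      have h2 := Real.sq_sqrt hdisc
      rw [← h1] at h2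
      refine mul_right_cancel₀ hq.ne' ?_
      linear_combination h2
    have hs : √(1 + t ^ 2) ^ 2 = 1 + t ^ 2 := Real.sq_sqrt (by positivity)
    have hs0 : √(1 + t ^ 2) ≠ 0 := (Real.sqrt_pos.2 (by positivity)).ne'
    refine ⟨fun i => (p i + t * q i) / √(1 + t ^ 2), fun i => (t * p i - q i) / √(1 + t ^ 2),
      ?_, fun i j => ?_⟩
    · simp only [lorentz] at hroot ⊢
      field_simp
      linear_combination hroot + 2 * t * hb
    · field_simp
      rw [hs]; ring

/-- Excludes `d > 1`. If `B < 0` then `A > 1`, so `(h - 1) A > f² ≥ P²` and the expression in `h0`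
would be negative. -/
theorem admissible_le_one {A B P Q f h : ℝ} (hA : 1 < A → f ^ 2 < h - 1) (hAB : A + B = 1)
    (hf : P ^ 2 + Q ^ 2 = f ^ 2) (h0 : 0 ≤ (h - 1) * A * B - B * P ^ 2 - A * Q ^ 2) : 0 ≤ B := by
  by_contra! hB
  have hA1 : 1 < A := by linarith
  have h1 := hA hA1
  have h2 : B * (f ^ 2 - (h - 1) * A) ≤ 0 := by nlinarith [sq_nonneg Q]
  have h3 : h - 1 < (h - 1) * A := by nlinarith [sq_nonneg f]
  have h4 := mul_pos_of_neg_of_neg hB (by linarith : f ^ 2 - (h - 1) * A < 0)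
  linarith

/-- A real moment matrix satisfying the positivity constraints is a sum of squares of null
vectors. -/
theorem exists_null_decomposition {A B P Q h : ℝ} (hA : 0 < A) (hB : 0 ≤ B) (hAB : A + B = 1)
    (hQ : B = 0 → Q = 0) (hr : 0 ≤ h - 1 - P ^ 2 / A - Q ^ 2 / B) :
    ∃ v : Fin 4 → Fin 4 → ℝ, (∀ n, lorentz (v n) = 0) ∧
      ∀ i j, ∑ n, v n i * v n j =
        (!![1, 0, 0, 1; 0, A, 0, P; 0, 0, B, Q; 1, P, Q, h] : Matrix (Fin 4) (Fin 4) ℝ) i j := by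
  have hA2 : √A ^ 2 = A := Real.sq_sqrt hA.le
  have hB2 : √B ^ 2 = B := Real.sq_sqrt hB
  have hr2 : √(h - 1 - P ^ 2 / A - Q ^ 2 / B) ^ 2 = _ := Real.sq_sqrt hr
  have hA0 : √A ≠ 0 := (Real.sqrt_pos.2 hA).ne'
  -- The starting vectors are the Cholesky factors of the moment matrix, with Lorentz values `-1`,
  -- `A`, `B`, `0`. As `A + B = 1`, two rotations cancel them: the first leaves `A - 1 = -B`, the
  -- second `-B + B = 0`.
  obtain ⟨n₁, q', hn₁, hq', e₁⟩ := exists_null_rotation (p := ![1, 0, 0, 1])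
    (q := ![0, √A, 0, P / √A]) (by simp [lorentz]) (by simp [lorentz])
  have hJ₁ : lorentz q' = -B := by
    rw [hq']; simp [lorentz, hA2]; linarith
  have hJ₃ : lorentz ![0, 0, √B, Q / √B] = B := by simp [lorentz, hB2]
  obtain ⟨n₂, n₃, hn₂, hn₃, e₂⟩ := exists_null_rotation (p := q')
    (q := ![0, 0, √B, Q / √B]) (by linarith) (by linarith)
  refine ⟨![n₁, n₂, n₃, ![0, 0, 0, √(h - 1 - P ^ 2 / A - Q ^ 2 / B)]], ?_, fun i j => ?_⟩
  · intro n
    fin_cases n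
    · exact hn₁
    · exact hn₂
    · simp [hn₃, hJ₁, hJ₃]
    · simp [lorentz]
  · have key : ∑ n, (![n₁, n₂, n₃, ![0, 0, 0, √(h - 1 - P ^ 2 / A - Q ^ 2 / B)]] :
        Fin 4 → Fin 4 → ℝ) n i *
        (![n₁, n₂, n₃, ![0, 0, 0, √(h - 1 - P ^ 2 / A - Q ^ 2 / B)]] : Fin 4 → Fin 4 → ℝ) n j =
        (![1, 0, 0, 1] : Fin 4 → ℝ) i * (![1, 0, 0, 1] : Fin 4 → ℝ) j +
        (![0, √A, 0, P / √A] : Fin 4 → ℝ) i * (![0, √A, 0, P / √A] : Fin 4 → ℝ) j +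
        (![0, 0, √B, Q / √B] : Fin 4 → ℝ) i * (![0, 0, √B, Q / √B] : Fin 4 → ℝ) j +
        (![0, 0, 0, √(h - 1 - P ^ 2 / A - Q ^ 2 / B)] : Fin 4 → ℝ) i *
          (![0, 0, 0, √(h - 1 - P ^ 2 / A - Q ^ 2 / B)] : Fin 4 → ℝ) j := by
      rw [Fin.sum_univ_four]
      have h1 := e₁ i j
      have h2 := e₂ i j
      simp only [cons_val_zero, cons_val_one, cons_val]
      linear_combination h1 + h2
    rw [key]
    -- For `B = 0` the quotient is `0` by convention, and the identity holds because `Q = 0`.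
    have hBQ : √B * (Q / √B) = Q := by
      rcases hB.eq_or_lt with h0 | h0
      · rw [hQ h0.symm]; simp
      · have := (Real.sqrt_pos.2 h0).ne'
        field_simp
    have hBQ' : Q / √B * √B = Q := by rw [mul_comm, hBQ]
    have hAP : √A * (P / √A) = P := by field_simp
    have hAP' : P / √A * √A = P := by rw [mul_comm, hAP]
    have hPP : P / √A * (P / √A) = P ^ 2 / A := by rw [div_mul_div_comm, ← sq, ← sq, hA2]
    have hQQ : Q / √B * (Q / √B) = Q ^ 2 / B := by rw [div_mul_div_comm, ← sq, ← sq, hB2]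
    rw [sq] at hA2 hB2 hr2
    fin_cases i <;> fin_cases j <;>
      simp [hA2, hB2, hr2, hBQ, hBQ', hAP, hAP', hPP, hQQ, -Real.mul_self_sqrt]

/-- A null vector of the Lorentz form lifts to a point of the conic `a c = b²`. -/
theorem exists_conic_point {v : Fin 4 → ℝ} (hv : lorentz v = 0) :
    ∃ a b c : ℂ, a * c = b ^ 2 ∧ a * star a = v 0 * v 0 ∧
      b * star a = v 0 * v 1 + v 0 * v 2 * Complex.I ∧ b * star b = v 0 * v 3 ∧
      c * star a = v 1 * v 1 - v 2 * v 2 + 2 * (v 1 * v 2) * Complex.I ∧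
      c * star b = v 1 * v 3 + v 2 * v 3 * Complex.I ∧ c * star c = v 3 * v 3 := by
  have hI := Complex.I_sq
  simp only [lorentz] at hv
  by_cases h0 : v 0 = 0
  · rw [h0] at hv
    have h1 : v 1 = 0 := by nlinarith [sq_nonneg (v 1), sq_nonneg (v 2)]
    have h2 : v 2 = 0 := by nlinarith [sq_nonneg (v 1), sq_nonneg (v 2)]
    exact ⟨0, 0, v 3, by simp, by simp [h0], by simp [h0], by simp [h0], by simp [h1, h2],
      by simp [h1, h2], by simp⟩
  · have h0' : (v 0 : ℂ) ≠ 0 := by exact_mod_cast h0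
    have hv' : (v 1 : ℂ) ^ 2 + (v 2 : ℂ) ^ 2 = v 0 * v 3 := by
      have : v 1 ^ 2 + v 2 ^ 2 = v 0 * v 3 := by linarith
      exact_mod_cast this
    have hz : star ((v 1 : ℂ) + v 2 * Complex.I) = v 1 - v 2 * Complex.I := by
      simp [sub_eq_add_neg]
    have h0s : star (v 0 : ℂ) = v 0 := Complex.conj_ofReal _
    -- The phase is chosen so that `a` is real; then `b = z` and the conic equation determines `c`.
    refine ⟨v 0, v 1 + v 2 * Complex.I, (v 1 + v 2 * Complex.I) ^ 2 / v 0, by field_simp, ?_, ?_,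
      ?_, ?_, ?_, ?_⟩
    · rw [h0s]
    · rw [h0s]; ring
    · rw [hz]; linear_combination hv' - (v 2 : ℂ) ^ 2 * hI
    · rw [h0s]; field_simp; linear_combination (v 2 : ℂ) ^ 2 * hI
    · rw [hz]; field_simp
      linear_combination (v 1 + v 2 * Complex.I) * hv'
        - (v 1 + v 2 * Complex.I) * (v 2 : ℂ) ^ 2 * hI
    · rw [star_div₀, star_pow, hz, h0s]; field_simp
      have e : (v 1 + v 2 * Complex.I) * (v 1 - v 2 * Complex.I) = v 0 * v 3 := by
        linear_combination hv' - (v 2 : ℂ) ^ 2 * hI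
      linear_combination ((v 1 + v 2 * Complex.I) * (v 1 - v 2 * Complex.I) + v 0 * v 3) * e

/-- The inequality makes the last Schur complement of the moment matrix nonnegative. The null
vectors obtained from that matrix lift to conic points, the values that the three forms are to take
on the frame vectors. -/
theorem hasParallelFrame_basis₃ {d f g θ : ℝ} (h : Admissible d f g θ) :
    HasParallelFrame (Submodule.span ℂ (basis₃ d f g θ)) := by
  obtain ⟨hg, hd, hf, hθ, hpos⟩ := h
  rw [← moments_polynomial_eq] at hpos
  obtain ⟨hre, him⟩ := polar_re_im f θ
  set κ := (f : ℂ) * Complex.exp (Complex.I * θ) with hκdef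
  set P := f * Real.cos θ with hP
  set Q := f * Real.sin θ with hQ
  set k := d ^ 2 + f ^ 2 + g ^ 2 with hk
  have hκ : κ = P + Q * Complex.I := by
    rw [← hre, ← him, Complex.re_add_im]
  have hfPQ : P ^ 2 + Q ^ 2 = f ^ 2 := by
    rw [hP, hQ]; linear_combination f ^ 2 * Real.sin_sq_add_cos_sq θ
  have hκκ : κ * star κ = (f : ℂ) ^ 2 := by
    rw [← Complex.ofReal_pow, ← hfPQ, hκ]
    simp only [star_add, star_mul', RCLike.star_def, Complex.conj_ofReal, Complex.conj_I]
    push_cast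
    linear_combination -(Q : ℂ) ^ 2 * Complex.I_sq
  have hpos' : 0 ≤ (k - 1) * ((1 + d) / 2) * ((1 - d) / 2) - (1 - d) / 2 * P ^ 2
      - (1 + d) / 2 * Q ^ 2 := by linarith
  have hB : 0 ≤ (1 - d) / 2 := admissible_le_one (A := (1 + d) / 2)
    (fun hd1 => by nlinarith [sq_pos_of_pos hg]) (by ring) hfPQ hpos'
  have hA : 0 < (1 + d) / 2 := by positivity
  have hQ0 : (1 - d) / 2 = 0 → Q = 0 := by
    intro h0
    rw [h0] at hpos'
    have : (1 + d) / 2 * Q ^ 2 ≤ 0 := by linarith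
    have h2 : Q ^ 2 ≤ 0 := by nlinarith
    exact pow_eq_zero_iff two_ne_zero |>.1 (le_antisymm h2 (sq_nonneg Q))
  have hr : 0 ≤ k - 1 - P ^ 2 / ((1 + d) / 2) - Q ^ 2 / ((1 - d) / 2) := by
    rcases hB.eq_or_lt with h0 | h0
    · have hd1 : d = 1 := by linarith
      rw [hQ0 h0.symm] at hfPQ ⊢
      rw [hk, hd1]
      norm_num
      nlinarith [sq_nonneg g]
    · have : (k - 1 - P ^ 2 / ((1 + d) / 2) - Q ^ 2 / ((1 - d) / 2)) =
          ((k - 1) * ((1 + d) / 2) * ((1 - d) / 2) - (1 - d) / 2 * P ^ 2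
            - (1 + d) / 2 * Q ^ 2) / (((1 + d) / 2) * ((1 - d) / 2)) := by
        have h0' : (1 - d) ≠ 0 := by linarith
        have hA' : (1 + d) ≠ 0 := by linarith
        field_simp
      rw [this]
      positivity
  obtain ⟨v, hv, hsum⟩ := exists_null_decomposition hA hB (by ring) hQ0 hr
  choose a b c hconic e00 e10 e11 e20 e21 e22 using fun n => exists_conic_point (hv n)
  have hg' : (g : ℂ) ≠ 0 := by exact_mod_cast hg.ne'
  have hsC : ∀ i j, ∑ n, (v n i : ℂ) * v n j =
      (((!![1, 0, 0, 1; 0, (1 + d) / 2, 0, P; 0, 0, (1 - d) / 2, Q; 1, P, Q, k] :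
        Matrix (Fin 4) (Fin 4) ℝ) i j : ℝ) : ℂ) := fun i j => by
    rw [← hsum]; push_cast; rfl
  have m00 : ∑ n, a n * star (a n) = 1 := by simp only [e00, hsC]; simp
  have m10 : ∑ n, b n * star (a n) = 0 := by
    simp only [e10, Finset.sum_add_distrib, ← Finset.sum_mul, hsC]; simp
  have m11 : ∑ n, b n * star (b n) = 1 := by simp only [e11, hsC]; simp
  have m20 : ∑ n, c n * star (a n) = d := by
    simp only [e20, Finset.sum_add_distrib, Finset.sum_sub_distrib, ← Finset.sum_mul,
      ← Finset.mul_sum, hsC]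
    simp
    ring
  have m21 : ∑ n, c n * star (b n) = κ := by
    simp only [e21, Finset.sum_add_distrib, ← Finset.sum_mul, hsC]
    simp [hκ]
  have m22 : ∑ n, c n * star (c n) = (d : ℂ) ^ 2 + f ^ 2 + g ^ 2 := by
    simp only [e22, hsC]
    simp [hk]
  have hstar : ∀ x y : Fin 4 → ℂ, ∑ n, x n * star (y n) = star (∑ n, y n * star (x n)) := by
    intro x y; simp [mul_comm]
  have hG : ∑ n, proj ![a n, b n, c n] =
      !![1, 0, (d : ℂ); 0, 1, star κ; (d : ℂ), κ, (d : ℂ) ^ 2 + f ^ 2 + g ^ 2] := by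
    have hentry : ∀ i j, (∑ n, proj ![a n, b n, c n]) i j =
        ∑ n, (![a n, b n, c n] : Fin 3 → ℂ) i * star ((![a n, b n, c n] : Fin 3 → ℂ) j) := by
      intro i j
      simp only [Matrix.sum_apply, proj, vecMulVec_apply, Pi.star_apply]
    ext i j
    rw [hentry]
    fin_cases i <;> fin_cases j
    · exact m00
    · exact (hstar a b).trans (by rw [m10]; simp)
    · exact (hstar a c).trans (by rw [m20]; simp)
    · exact m10
    · exact m11
    · exact (hstar b c).trans (by rw [m21]; simp)
    · exact m20
    · exact m21
    · exact m22
  -- `M` inverts the matrix with rows `(1, 0, 0)`, `(0, 1, 0)`, `(d, κ, g)`, so it recovers a frame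
  -- vector from the values `a n`, `b n`, `c n` and carries the Gram matrix `hG` to the identity.
  set M : Matrix (Fin 3) (Fin 3) ℂ := !![1, 0, 0; 0, 1, 0; -(d : ℂ) / g, -κ / g, 1 / g] with hM
  refine ⟨4, fun n => M *ᵥ ![a n, b n, c n], ?_, fun n => parallelAt_span ?_⟩
  · simp only [proj_mulVec]
    rw [← Matrix.sum_mul, ← Matrix.mul_sum, hG]
    have hκκ' : κ * (starRingEnd ℂ) κ = (f : ℂ) ^ 2 := hκκ
    clear_value κ
    ext i j
    fin_cases i <;> fin_cases j <;>
      simp [hM, Matrix.mul_apply, Fin.sum_univ_three] <;> field_simp <;> (try ring1)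
    linear_combination -hκκ'
  · have hw : M *ᵥ ![a n, b n, c n] = ![a n, b n, (c n - d * a n - κ * b n) / g] := by
      ext i
      fin_cases i <;> simp [hM, mulVec, dotProduct, Fin.sum_univ_three]
      field_simp
      ring
    have h1 : contr (M *ᵥ ![a n, b n, c n])
        (prodVec (ket 0) (ket 0) + prodVec (ket 1) (ket 1) : Fin 3 × Fin 3 → ℂ)
        = ![a n, b n, 0] := by
      rw [hw, map_add, contr_prodVec, contr_prodVec]
      ext i
      fin_cases i <;> simp [ket]
    have h2 : contr (M *ᵥ ![a n, b n, c n])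
        (prodVec (ket 0) (ket 1) + prodVec (ket 1) ((d : ℂ) • ket 0 + κ • ket 1 + (g : ℂ) • ket 2) :
          Fin 3 × Fin 3 → ℂ) = ![b n, c n, 0] := by
      rw [hw, map_add, contr_prodVec, contr_prodVec]
      ext i
      fin_cases i <;> simp [ket, add_dotProduct]
      field_simp
      ring
    have h3 : Par ![a n, b n, 0] ![b n, c n, 0] := by
      intro i j
      have := hconic n
      fin_cases i <;> fin_cases j <;> simp <;> grind
    rintro _ (rfl | rfl) _ (rfl | rfl)
    · intro i j; ring
    · rw [h1, h2]; exact h3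
    · rw [h1, h2]; intro i j; linear_combination h3 j i
    · intro i j; ring

end Existence

/-! ### Local operations and assembly of the classification -/

section Main

variable {A A' : Type*}

theorem sum_proj_ket : ∑ i : Fin 3, proj (ket i) = 1 := by
  ext i j
  fin_cases i <;> fin_cases j <;>
    simp [Fin.sum_univ_three, proj, vecMulVec_apply, ket]

theorem contr_localOp {B : Type*} [Fintype A] [Fintype B] (W : Matrix A' A ℂ) (X : Matrix B B ℂ)
    (w : B → ℂ) (v : A × B → ℂ) :
    contr w (localOp W X v) = W *ᵥ contr (Xᵀ *ᵥ w) v := by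
  ext i
  simp only [contr_apply, localOp, mulVecLin_apply, mulVec, dotProduct, Fintype.sum_prod_type,
    kroneckerMap_apply, transpose_apply, Finset.sum_mul, Finset.mul_sum]
  rw [Finset.sum_comm]
  refine Finset.sum_congr rfl fun a _ => ?_
  rw [Finset.sum_comm]
  exact Finset.sum_congr rfl fun b _ => Finset.sum_congr rfl fun b' _ => by ring

/-- An arbitrary `W` maps a line into a line, while a unitary change on the second factor carries
frames to frames. -/
theorem HasParallelFrame.map_localOp [Fintype A] {V : Submodule ℂ (A × Fin 3 → ℂ)}
    (h : HasParallelFrame V) (W : Matrix A' A ℂ) {X : Matrix (Fin 3) (Fin 3) ℂ}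
    (hX : X ∈ Matrix.unitaryGroup (Fin 3) ℂ) : HasParallelFrame (V.map (localOp W X)) := by
  obtain ⟨N, u, hu, hpar⟩ := h
  have h1 : Xᵀ * Xᵀᴴ = 1 := by
    have := congrArg transpose (Matrix.mem_unitaryGroup_iff'.1 hX)
    rw [transpose_mul, star_eq_conjTranspose, transpose_one] at this
    exact this
  refine ⟨N, fun n => Xᵀᴴ *ᵥ u n, ?_, fun n => ?_⟩
  · simp only [proj_mulVec]
    rw [← Matrix.sum_mul, ← Matrix.mul_sum, hu, Matrix.mul_one, conjTranspose_conjTranspose]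
    exact mul_eq_one_comm.1 h1
  · obtain ⟨x, hx⟩ := hpar n
    refine ⟨W *ᵥ x, ?_⟩
    rintro _ ⟨v, hv, rfl⟩
    obtain ⟨c, hc⟩ := hx v hv
    exact ⟨c, by rw [contr_localOp, mulVec_mulVec, h1, one_mulVec, hc, mulVec_smul]⟩

theorem hasParallelFrame_of_canonicalBasis {S : Set (Fin 3 × Fin 3 → ℂ)}
    (hS : IsCanonicalBasis S) : HasParallelFrame (Submodule.span ℂ S) := by
  rcases hS with rfl | rfl | ⟨d, f, g, θ, h, rfl⟩
  · refine ⟨3, ket, sum_proj_ket, fun k => parallelAt_span ?_⟩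
    rintro _ (rfl | rfl) _ (rfl | rfl) i j <;> fin_cases k <;> simp [ket, mul_comm]
  · refine ⟨3, ket, sum_proj_ket, fun k => parallelAt_span ?_⟩
    rintro _ (rfl | rfl) _ (rfl | rfl) i j <;> fin_cases k <;> simp [ket, mul_comm]
  · exact hasParallelFrame_basis₃ h

theorem IsCanonical.hasParallelFrame {V : Submodule ℂ (A × Fin 3 → ℂ)} (h : IsCanonical V) :
    HasParallelFrame V := by
  obtain ⟨S, hS, W, X, hX, rfl⟩ := h
  rw [← Submodule.map_span]
  exact (hasParallelFrame_of_canonicalBasis hS).map_localOp W hX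

theorem hasParallelFrame_of_finrank_eq_one {V : Submodule ℂ (A × Fin 3 → ℂ)}
    (hV : Module.finrank ℂ V = 1) : HasParallelFrame V := by
  obtain ⟨v, -, hv⟩ := finrank_eq_one_iff'.1 hV
  refine ⟨3, ket, sum_proj_ket, fun k => ⟨contr (ket k) (v : A × Fin 3 → ℂ), fun v' hv' => ?_⟩⟩
  obtain ⟨c, hc⟩ := hv ⟨v', hv'⟩
  refine ⟨c, ?_⟩
  rw [← map_smul]
  exact congrArg _ (congrArg Subtype.val hc).symm

theorem hasParallelFrame_span_ket (x : Fin 3 → A → ℂ) :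
    HasParallelFrame (Submodule.span ℂ (Set.range fun i => prodVec (x i) (ket i))) := by
  refine ⟨3, ket, sum_proj_ket, fun k => parallelAt_span ?_⟩
  rintro _ ⟨i, rfl⟩ _ ⟨j, rfl⟩ a b
  simp only [contr_prodVec, ket, single_dotProduct, one_mul, Pi.smul_apply, Pi.single_apply,
    smul_eq_mul]
  by_cases hi : i = k <;> by_cases hj : j = k <;> simp [hi, hj, mul_comm]

theorem range_three {M : Type*} (F : Fin 3 → M) : Set.range F = {F 0, F 1, F 2} := by
  ext v
  simp only [Set.mem_range, Set.mem_insert_iff, Set.mem_singleton_iff, Fin.exists_fin_succ,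
    eq_comm (a := v)]
  simp

theorem exists_luEquivalent [Fintype A] [DecidableEq A] {V : Submodule ℂ (A × Fin 3 → ℂ)}
    (hV : Module.finrank ℂ V = 3) (h : HasParallelBasis V) :
    ∃ x : Fin 3 → A → ℂ,
      LUEquivalent (Submodule.span ℂ (Set.range fun i => prodVec (x i) (ket i))) V := by
  obtain ⟨ε, hε, hpar⟩ := h
  obtain ⟨x, hx⟩ := exists_mem_smul hpar
  refine ⟨x, 1, one_mem _, _, mem_unitaryGroup_of_isOrthonormal hε, ?_⟩
  rw [Submodule.map_span, ← Set.range_comp, IsDual.eq_span hε hx hV]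
  congr 2
  ext1 i
  simp only [Function.comp_apply, localOp_prodVec, one_mulVec, mulVec_ket]
  rfl

end Main

end EBSpace

theorem mainTheorem1 (m : ℕ) (V : Submodule ℂ (Fin m × Fin 3 → ℂ)) :
    (V ≠ ⊥ → EBSpace.IsEB V →
      Module.finrank ℂ V = 1 ∨ Module.finrank ℂ V = 2 ∨ Module.finrank ℂ V = 3) ∧
    (Module.finrank ℂ V = 1 → EBSpace.IsEB V) ∧
    (Module.finrank ℂ V = 2 →
      (EBSpace.IsEB V ↔
        ∃ S : Set (Fin 3 × Fin 3 → ℂ), EBSpace.IsCanonicalBasis S ∧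
          ∃ W : Matrix (Fin m) (Fin 3) ℂ, ∃ X ∈ Matrix.unitaryGroup (Fin 3) ℂ,
            V = Submodule.span ℂ (EBSpace.localOp W X '' S))) ∧
    (Module.finrank ℂ V = 3 →
      (EBSpace.IsEB V ↔
        ∃ x y z : Fin m → ℂ,
          EBSpace.LUEquivalent
            (Submodule.span ℂ {EBSpace.prodVec x (EBSpace.ket (0 : Fin 3)),
              EBSpace.prodVec y (EBSpace.ket (1 : Fin 3)),
              EBSpace.prodVec z (EBSpace.ket (2 : Fin 3))}) V)) := by
  have hne : Module.finrank ℂ V ≠ 0 → V ≠ ⊥ := by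
    rintro h rfl
    exact h (finrank_bot ℂ _)
  refine ⟨fun hV h => ?_, fun hV => ?_, fun hV => ?_, fun hV => ?_⟩
  · have h3 := EBSpace.finrank_le_three (EBSpace.hasParallelFrame_of_isEB hV h)
    have h0 : Module.finrank ℂ V ≠ 0 := fun h0 => hV (Submodule.finrank_eq_zero.1 h0)
    omega
  · exact EBSpace.isEB_of_hasParallelFrame (EBSpace.hasParallelFrame_of_finrank_eq_one hV)
  · rw [EBSpace.isEB_iff (hne (by omega))]
    exact ⟨EBSpace.isCanonical_of_hasParallelFrame hV, EBSpace.IsCanonical.hasParallelFrame⟩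
  · rw [EBSpace.isEB_iff (hne (by omega))]
    constructor
    · intro h
      obtain ⟨x, hx⟩ := EBSpace.exists_luEquivalent hV
        (EBSpace.hasParallelBasis_of_finrank_eq_three h hV)
      rw [EBSpace.range_three] at hx
      exact ⟨x 0, x 1, x 2, hx⟩
    · rintro ⟨x, y, z, U, -, U', hU', rfl⟩
      have h := EBSpace.hasParallelFrame_span_ket ![x, y, z]
      rw [EBSpace.range_three] at h
      exact h.map_localOp U hU'
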